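/- Let $F(\vec x,\vec y)=C_1\land\dots\land C_k$ be a specification in conjunctive normal form with input variables $\vec x=(x_1,\dots,x_m)$ and output variables $\vec y=(y_1,\dots,y_n)$. It is realizable if for every input assignment $\hat x$ there is an output assignment $\hat y$ with $F(\hat x,\hat y)=1$. Its set of input clauses $S_{\vec x}$ consists of the clauses $C_i|_{\vec x}$, where $C_i|_{\vec x}$ is the disjunction of the literals of $C_i$ over $\vec x$. The consensus graph of $S_{\vec x}$ has the elements of $S_{\vec x}$ as vertices, two distinct clauses being adjacent if and only if they contain no complementary pair of literals. A decision list is an expression "if $f_1(\vec x)$ then $\hat y_1$ else if $f_2(\vec x)$ then $\hat y_2$ else $\dots$" with formulas $f_i$ in the input variables and output assignments $\hat y_i$; it implements a realizable $F$ if for every $\hat x$ the output $\hat y$ that it selects satisfies $F(\hat x,\hat y)=1$. We say that synthesis can be performed in $\mathrm{P}^{\mathrm{NP}}$ for a class $\mathcal C$ of CNF specifications if there is a deterministic polynomial-time machine with an oracle for a language in $\mathrm{NP}$ that, given any realizable $F\in\mathcal C$, outputs a decision list (with formulas $f_i$ in CNF) that implements $F$. Theorem. (1) Let $\mathcal C$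 be a class of CNF specifications for which there is a polynomial $q$ such that for every $F\in\mathcal C$ the consensus graph of the input clauses of $F$ has at most $q(|F|)$ maximal cliques, where $|F|$ is the size of $F$. Then synthesis can be performed in $\mathrm{P}^{\mathrm{NP}}$ for $\mathcal C$. (2) There is a polynomial $q$ such that every finite planar graph with $N$ vertices has at most $q(N)$ maximal cliques, and the same holds for chordal graphs. Consequently synthesis can be performed in $\mathrm{P}^{\mathrm{NP}}$ for the specifications whose consensus graph of the input clauses is planar, and for those whose consensus graph of the input clauses is chordal. -/

import Mathlib

namespace BoolSynth

/-! ### Clauses, specifications and synthesis -/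

/-- A clause over the variables `V`: the finite set of its literals. The literal `(v, true)` is the
variable `v`, the literal `(v, false)` is its negation. -/
abbrev Clause (V : Type) := Finset (V × Bool)

/-- The truth value of a clause under an assignment: some literal of the clause is true. -/
def Clause.eval {V : Type} [DecidableEq V] (C : Clause V) (a : V → Bool) : Bool :=
  decide (∃ l ∈ C, a l.1 = l.2)

/-- A specification in conjunctive normal form with input variables `Fin numIn` and output
variables `Fin numOut`: the conjunction of a list of clauses over both kinds of variables. -/
structure Spec where
  numIn : ℕ
  numOut : ℕ
  clauses : List (Clause (Fin numIn ⊕ Fin numOut))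

/-- `F.Holds x y`: the input assignment `x` and the output assignment `y` satisfy `F`. -/
def Spec.Holds (F : Spec) (x : Fin F.numIn → Bool) (y : Fin F.numOut → Bool) : Prop :=
  ∀ C ∈ F.clauses, C.eval (Sum.elim x y) = true

/-- Every input assignment has an output assignment that satisfies the specification with it. -/
def Spec.Realizable (F : Spec) : Prop :=
  ∀ x : Fin F.numIn → Bool, ∃ y : Fin F.numOut → Bool, F.Holds x y

/-- The input part of a clause: the disjunction of its input literals. -/
def inPart {m n : ℕ} (C : Clause (Fin m ⊕ Fin n)) : Clause (Fin m) :=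
  Finset.univ.filter fun l => (Sum.inl l.1, l.2) ∈ C

/-- The output part of a clause: the disjunction of its output literals. -/
def outPart {m n : ℕ} (C : Clause (Fin m ⊕ Fin n)) : Clause (Fin n) :=
  Finset.univ.filter fun l => (Sum.inr l.1, l.2) ∈ C

/-- The set of input clauses of a specification. -/
def Spec.inputClauses (F : Spec) : Finset (Clause (Fin F.numIn)) :=
  (F.clauses.map inPart).toFinset

/-- A decision list for `m` inputs and `n` outputs:
`if f₁(x) then y₁ else if f₂(x) then y₂ else …`, where each test `fᵢ` is a formula in the input
variables, given as a list of clauses whose conjunction it is, and each `yᵢ` is an assignment of the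
output variables. -/
abbrev DecisionList (m n : ℕ) := List (List (Clause (Fin m)) × (Fin n → Bool))

/-- The partial function computed by a decision list: the output of the first test that is true. -/
def DecisionList.eval {m n : ℕ} (D : DecisionList m n) (x : Fin m → Bool) :
    Option (Fin n → Bool) :=
  (D.find? fun d => d.1.all fun C => C.eval x).map Prod.snd

/-- The partial function `g` implements the specification `F`: on every input assignment in the
domain of `F` it is defined and its value satisfies `F`. -/
def Spec.Implements (F : Spec) (g : (Fin F.numIn → Bool) → Option (Fin F.numOut → Bool)) : Prop :=
  ∀ x, (∃ y, F.Holds x y) → ∃ y, g x = some y ∧ F.Holds x y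

/-! ### Graphs -/

/-- The two clauses contain a complementary pair of literals. -/
def Conflict {V : Type} (C D : Clause V) : Prop :=
  ∃ (v : V) (b : Bool), (v, b) ∈ C ∧ (v, !b) ∈ D

/-- The conflict graph of a set of clauses: two distinct clauses are adjacent if they contain a
complementary pair of literals. -/
def conflictGraph {V : Type} (S : Finset (Clause V)) : SimpleGraph S where
  Adj C D := C ≠ D ∧ Conflict C.1 D.1
  symm := ⟨fun _ _ h => ⟨h.1.symm, by
    obtain ⟨v, b, h1, h2⟩ := h.2
    exact ⟨v, !b, h2, by simpa using h1⟩⟩⟩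
  loopless := ⟨fun _ h => h.1 rfl⟩

/-- The consensus graph of a set of clauses: the complement of its conflict graph. -/
def consensusGraph {V : Type} (S : Finset (Clause V)) : SimpleGraph S :=
  (conflictGraph S)ᶜ

/-- The number of (inclusion-)maximal cliques of a finite graph. -/
noncomputable def numMaximalCliques {V : Type} (G : SimpleGraph V) : ℕ :=
  {s : Set V | Maximal G.IsClique s}.ncard

/-- A graph is chordal if every cycle of length at least four has a chord: an edge that joins two
vertices of the cycle and is not an edge of the cycle. -/
def IsChordal {V : Type} (G : SimpleGraph V) : Prop :=
  ∀ (v : V) (c : G.Walk v v), c.IsCycle → 4 ≤ c.length →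
    ∃ a ∈ c.support, ∃ b ∈ c.support, G.Adj a b ∧ s(a, b) ∉ c.edges

/-- A graph is planar if it can be drawn in the Euclidean plane without crossings: the vertices are
distinct points, every edge is a simple arc that joins its two ends, an arc meets the set of vertices
only in its endpoints, and the arcs of distinct edges meet only in endpoints of both. -/
def IsPlanar {V : Type} (G : SimpleGraph V) : Prop :=
  ∃ (pos : V → EuclideanSpace ℝ (Fin 2))
    (arc : G.edgeSet → C(unitInterval, EuclideanSpace ℝ (Fin 2))),
    Function.Injective pos ∧
    (∀ e, Function.Injective (arc e)) ∧
    (∀ e : G.edgeSet, ∃ u v, (e : Sym2 V) = s(u, v) ∧ arc e 0 = pos u ∧ arc e 1 = pos v) ∧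
    (∀ e t w, arc e t = pos w → t = 0 ∨ t = 1) ∧
    (∀ e f, e ≠ f → ∀ t t', arc e t = arc f t' → (t = 0 ∨ t = 1) ∧ (t' = 0 ∨ t' = 1))

/-! ### Encodings by bit strings -/

/-- A clause over `m` variables as a bit string of length `2 * m`: for each variable, whether it
occurs positively and whether it occurs negatively. -/
def clauseBits {m : ℕ} (C : Clause (Fin m)) : List Bool :=
  (List.finRange m).flatMap fun i => [decide ((i, true) ∈ C), decide ((i, false) ∈ C)]

/-- A specification as a bit string: the numbers of input and of output variables in unary, then the
clauses, each preceded by the marker `true` and written as its input part followed by its output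
part, and a final `false`. -/
def Spec.encode (F : Spec) : List Bool :=
  List.replicate F.numIn true ++ [false] ++ List.replicate F.numOut true ++ [false] ++
    (F.clauses.flatMap fun C => true :: (clauseBits (inPart C) ++ clauseBits (outPart C))) ++ [false]

/-- The size of a specification: the length of its encoding. -/
def Spec.size (F : Spec) : ℕ := F.encode.length

/-- A decision list as a bit string: its entries, each preceded by the marker `true`, and a final
`false`. An entry is the list of the clauses of its test, each preceded by `true`, then `false`, then
the values of the output variables. -/
def DecisionList.encode {m n : ℕ} (D : DecisionList m n) : List Bool :=
  (D.flatMap fun d => true :: ((d.1.flatMap fun C => true :: clauseBits C) ++ [false] ++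
    (List.finRange n).map d.2)) ++ [false]

/-! ### Machines with an oracle, and the classes NP and (functional) P with an NP oracle -/

/-- Programs of a deterministic oracle machine with finitely many stacks of bits (a program uses only
the finitely many stacks that it mentions). Every elementary instruction and every test looks only at
the top of one stack and changes it by at most one bit, so that a step is a bounded number of steps
of a multitape oracle Turing machine. -/
inductive Prog : Type
  /-- do nothing -/
  | skip : Prog
  /-- push the bit `b` on stack `r` -/
  | push (r : ℕ) (b : Bool) : Prog
  /-- remove the top of stack `r` (no effect on an empty stack) -/
  | pop (r : ℕ) : Prog
  /-- ask the oracle whether the content of stack `r` is in its language and push the answer on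
  stack `a` -/
  | query (r a : ℕ) : Prog
  /-- sequential composition -/
  | seq (P Q : Prog) : Prog
  /-- branch: `P` if stack `r` is empty, `Q` if its top is `false`, `R` if its top is `true` -/
  | branch (r : ℕ) (P Q R : Prog) : Prog
  /-- repeat `P` as long as stack `r` is not empty -/
  | loop (r : ℕ) (P : Prog) : Prog

/-- The content of the stacks; the head of a list is the top of the stack. -/
abbrev Store := ℕ → List Bool

/-- `Run O P s t s'`: with the oracle `O`, the program `P` started on the store `s` halts after
exactly `t` steps with the store `s'`. Every elementary instruction, oracle query and evaluation of
a test is one step. -/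
inductive Run (O : Language Bool) : Prog → Store → ℕ → Store → Prop
  | skip (s : Store) : Run O Prog.skip s 1 s
  | push (s : Store) (r : ℕ) (b : Bool) :
      Run O (Prog.push r b) s 1 (Function.update s r (b :: s r))
  | pop (s : Store) (r : ℕ) :
      Run O (Prog.pop r) s 1 (Function.update s r (s r).tail)
  | query (s : Store) (r a : ℕ) (b : Bool) (h : b = true ↔ s r ∈ O) :
      Run O (Prog.query r a) s 1 (Function.update s a (b :: s a))
  | seq {P Q : Prog} {s s' s'' : Store} {t t' : ℕ} (hP : Run O P s t s') (hQ : Run O Q s' t' s'') :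
      Run O (Prog.seq P Q) s (t + t') s''
  | branch_nil {r : ℕ} {P Q R : Prog} {s s' : Store} {t : ℕ} (h : s r = []) (hP : Run O P s t s') :
      Run O (Prog.branch r P Q R) s (t + 1) s'
  | branch_false {r : ℕ} {P Q R : Prog} {s s' : Store} {t : ℕ} (h : (s r).head? = some false)
      (hQ : Run O Q s t s') : Run O (Prog.branch r P Q R) s (t + 1) s'
  | branch_true {r : ℕ} {P Q R : Prog} {s s' : Store} {t : ℕ} (h : (s r).head? = some true)
      (hR : Run O R s t s') : Run O (Prog.branch r P Q R) s (t + 1) s'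
  | loop_nil {r : ℕ} {P : Prog} {s : Store} (h : s r = []) : Run O (Prog.loop r P) s 1 s
  | loop_cons {r : ℕ} {P : Prog} {s s' s'' : Store} {t t' : ℕ} (h : s r ≠ []) (hP : Run O P s t s')
      (hL : Run O (Prog.loop r P) s' t' s'') : Run O (Prog.loop r P) s (t + t' + 1) s''

/-- The initial store: `x` on stack 0, `w` on stack 1, all other stacks empty. -/
def load (x w : List Bool) : Store :=
  fun r => if r = 0 then x else if r = 1 then w else []

/-- The class NP: the languages with a polynomial-time verifier (a machine whose oracle is the empty
language, that is, a machine without an oracle) and certificates of polynomial length. The answer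
`V x w` of the verifier on the word `x` and the certificate `w` is left on top of stack 0. -/
def InNP (L : Language Bool) : Prop :=
  ∃ (P : Prog) (p q : Polynomial ℕ) (V : List Bool → List Bool → Bool),
    (∀ x w, ∃ t s, Run 0 P (load x w) t s ∧ t ≤ p.eval (x.length + w.length) ∧
      (s 0).head? = some (V x w)) ∧
    ∀ x, x ∈ L ↔ ∃ w, w.length ≤ q.eval x.length ∧ V x w = true

/-- The functions on bit strings that are computed in polynomial time, on all inputs, by a
deterministic machine with an oracle for a language in NP. Input and output are on stack 0. -/
def InFPNP (f : List Bool → List Bool) : Prop :=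
  ∃ L : Language Bool, InNP L ∧ ∃ (P : Prog) (p : Polynomial ℕ),
    ∀ w, ∃ t s, Run L P (load w []) t s ∧ t ≤ p.eval w.length ∧ s 0 = f w

/-- Synthesis can be performed in polynomial time with an NP oracle for the realizable specifications
in `𝒞`: from each of them the machine computes a decision list that implements it. -/
def SynthesisInPNP (𝒞 : Set Spec) : Prop :=
  ∃ f : List Bool → List Bool, InFPNP f ∧ ∀ F ∈ 𝒞, F.Realizable →
    ∃ D : DecisionList F.numIn F.numOut, f F.encode = D.encode ∧ F.Implements D.eval

end BoolSynth

/-! An input assignment matters only through the set of input clauses that it falsifies. If `F`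
holds at `(x, y)` and every input clause falsified by `x'` is falsified by `x`, then `F` holds at
`(x', y)` as well. A decision list may therefore test the conjunction of the input clauses satisfied
by `x` and answer `y`, and one entry for each inclusion-maximal falsified set suffices.

These sets are few. Each falsified set is a clique of the consensus graph (`isClique_falsified`),
and all falsified sets inside one clique lie in a single falsified set
(`exists_falsified_superset`). For a realizable specification, distinct entries with maximal
falsified sets thus belong to distinct maximal cliques (`length_le_numMaximalCliques`).

To find them, the machine writes the encoding of the list bit by bit, asks the oracle whether a
prefix is extendable, and prefers `true`. In a test, each falsified clause is replaced by the full
clause, all of whose bits are `true`. Then the pointwise order of encoded tests is the inclusion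
order of falsified sets (`exceeds_testBits`), and the lexicographically greatest new block is
maximal in it (`GoodEntries.exists_append`). The oracle also demands that the new falsified set be
contained in no earlier one. When no such block is left, every input passes some test. The programs
`verifier` and `synthesizer` realize this within explicit polynomial time bounds.

A planar graph has no clique of five vertices, hence at most `N ^ 4 + 1` maximal cliques. The
drawing of such a clique is excluded by a parity count of winding numbers (`not_drawable_five`). In
a chordal graph, adding a vertex `v` to a vertex set `S` creates at most `|S|` further maximal
cliques, which gives a quadratic bound (`IsChordal.ncard_maximal_cliques_within_le`). -/

namespace BoolSynth

/-! ### Planar graphs have no clique with five vertices -/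

open Complex in
/-- A nowhere zero continuous path in the complex plane has a continuous logarithm. -/
theorem exists_path_log (γ : C(unitInterval, ℂ)) (h : ∀ t, γ t ≠ 0) :
    ∃ A : C(unitInterval, ℂ), ∀ t, exp (A t) = γ t := by
  obtain ⟨A, hA, -⟩ := isCoveringMap_exp.exists_path_lifts
    ⟨fun t => (⟨γ t, h t⟩ : {z : ℂ // z ≠ 0}), by fun_prop⟩ (log (γ 0))
    (Subtype.ext (exp_log (h 0)).symm)
  exact ⟨A, fun t => congrArg Subtype.val (congrFun hA t)⟩

open Complex in
/-- A nowhere zero continuous function on a square has a continuous logarithm. -/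
theorem exists_square_log (H : C(unitInterval × unitInterval, ℂ)) (h : ∀ t, H t ≠ 0) :
    ∃ A : C(unitInterval × unitInterval, ℂ), ∀ t, exp (A t) = H t := by
  obtain ⟨f, hf⟩ := exists_path_log (H.comp ⟨fun a => ((0 : unitInterval), a), by fun_prop⟩)
    fun _ => h _
  let H' : C(unitInterval × unitInterval, {z : ℂ // z ≠ 0}) := ⟨fun t => ⟨H t, h t⟩, by fun_prop⟩
  refine ⟨isCoveringMap_exp.liftHomotopy H' f fun a => Subtype.ext (hf a).symm, fun t => ?_⟩
  exact congrArg Subtype.val (congrFun (isCoveringMap_exp.liftHomotopy_lifts H' f _) t)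

open Complex in
/-- Two continuous logarithms of the same path have the same increment. -/
theorem log_increment_unique {f g : unitInterval → ℂ} (hf : Continuous f) (hg : Continuous g)
    (h : ∀ t, exp (f t) = exp (g t)) : f 1 - f 0 = g 1 - g 0 := by
  have hc : Continuous fun t => g t + (f 0 - g 0) := by fun_prop
  -- The initial difference is a period of `exp`, so `g` shifted by it is another lift of the same
  -- path. It agrees with `f` at `0`, and lifts with a common value coincide.
  have h0 : exp (f 0 - g 0) = 1 := by rw [exp_sub, h 0, div_self (exp_ne_zero _)]
  have key : f = fun t => g t + (f 0 - g 0) := by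
    apply isCoveringMap_exp.eq_of_comp_eq hf hc _ 0 (by simp)
    funext t
    simp [exp_add, h0, h t]
  rw [congrFun key 1]; ring

open Complex in
/-- The increments of the arguments along the four sides of the square spanned by two disjoint paths
add up to zero. -/
theorem log_increment_square {e f : C(unitInterval, ℂ)} (hef : ∀ s t, e s ≠ f t)
    {a b c d : C(unitInterval, ℂ)}
    (ha : ∀ t, exp (a t) = e t - f 0) (hb : ∀ t, exp (b t) = f t - e 1)
    (hc : ∀ t, exp (c t) = e t - f 1) (hd : ∀ t, exp (d t) = f t - e 0) :
    (a 1 - a 0) + (b 1 - b 0) = (c 1 - c 0) + (d 1 - d 0) := by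
  obtain ⟨G, hG⟩ := exists_square_log ⟨fun x => e x.1 - f x.2, by fun_prop⟩
    fun x => sub_ne_zero.2 (hef _ _)
  simp only [ContinuousMap.coe_mk] at hG
  have h1 := log_increment_unique (f := fun s => G (s, 0)) (g := a) (by fun_prop) (by fun_prop)
    fun t => by rw [hG, ha]
  have h2 := log_increment_unique (f := fun s => G (s, 1)) (g := c) (by fun_prop) (by fun_prop)
    fun t => by rw [hG, hc]
  -- On the two sides along `f` the function is the negative of the one whose logarithm is given.
  -- The constant `π * I` accounts for the sign and leaves the increment unchanged.
  have h3 := log_increment_unique (f := fun s => G (1, s)) (g := fun t => b t + Real.pi * I)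
    (by fun_prop) (by fun_prop) fun t => by rw [hG, exp_add, hb, exp_pi_mul_I]; ring
  have h4 := log_increment_unique (f := fun s => G (0, s)) (g := fun t => d t + Real.pi * I)
    (by fun_prop) (by fun_prop) fun t => by rw [hG, exp_add, hd, exp_pi_mul_I]; ring
  linear_combination h2 - h1 + h4 - h3

open Complex in
/-- The complete graph on five vertices has no drawing in the complex plane in which independent
edges are disjoint and no edge passes through a third vertex. -/
theorem not_drawable_five (p : Fin 5 → ℂ) (hp : Function.Injective p)
    (γ : Fin 5 → Fin 5 → C(unitInterval, ℂ))
    (h0 : ∀ i j, i < j → γ i j 0 = p i) (h1 : ∀ i j, i < j → γ i j 1 = p j)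
    (hv : ∀ i j w, i < j → w ≠ i → w ≠ j → ∀ t, γ i j t ≠ p w)
    (hd : ∀ i j k l, i < j → k < l → i ≠ k → i ≠ l → j ≠ k → j ≠ l →
      ∀ s t, γ i j s ≠ γ k l t) : False := by
  -- `A i j w` is a logarithm of the edge `ij` seen from the vertex `w`. For the other triples a
  -- dummy value makes `choose` yield a total function.
  have hA : ∀ i j w, ∃ A : C(unitInterval, ℂ), (i < j ∧ w ≠ i ∧ w ≠ j) →
      ∀ t, exp (A t) = γ i j t - p w := by
    intro i j w
    by_cases h : i < j ∧ w ≠ i ∧ w ≠ j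
    · obtain ⟨A, hA⟩ := exists_path_log (γ i j - ContinuousMap.const _ (p w))
        fun t => sub_ne_zero.2 (hv i j w h.1 h.2.1 h.2.2 t)
      exact ⟨A, fun _ t => hA t⟩
    · exact ⟨0, fun h' => absurd h' h⟩
  choose A hA using hA
  -- Fixed logarithms of the differences of vertices, chosen so that exchanging the two vertices
  -- changes the value by exactly `± π * I`. The sign is `σ`.
  let θ : Fin 5 → Fin 5 → ℂ := fun a b =>
    if a < b then log (p a - p b) else log (p b - p a) + Real.pi * I
  have hθ : ∀ a b, a ≠ b → exp (θ a b) = p a - p b := by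
    intro a b hab
    have h1 : p a - p b ≠ 0 := sub_ne_zero.2 (hp.ne hab)
    have h2 : p b - p a ≠ 0 := sub_ne_zero.2 (hp.ne hab.symm)
    by_cases h : a < b
    · simp only [θ, if_pos h, exp_log h1]
    · simp only [θ, if_neg h, exp_add, exp_log h2, exp_pi_mul_I]; ring
  let σ : Fin 5 → Fin 5 → ℤ := fun a b => if a < b then -1 else 1
  have hσ : ∀ a b, a ≠ b → θ a b - θ b a = σ a b * (Real.pi * I) := by
    intro a b hab
    rcases lt_or_gt_of_ne hab with h | h <;> simp [θ, σ, h, h.not_gt]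
  -- The integer `n i j w` is the winding of the edge `ij` around `w` relative to the fixed
  -- logarithms.
  have hn : ∀ i j w, ∃ n : ℤ, (i < j ∧ w ≠ i ∧ w ≠ j) →
      A i j w 1 - A i j w 0 = θ j w - θ i w + n * (2 * Real.pi * I) := by
    intro i j w
    by_cases h : i < j ∧ w ≠ i ∧ w ≠ j
    · obtain ⟨n, hn⟩ := exp_eq_exp_iff_exists_int.1
        (show exp (A i j w 1 - A i j w 0) = exp (θ j w - θ i w) by
          rw [exp_sub, exp_sub, hA i j w h, hA i j w h, hθ j w h.2.2.symm, hθ i w h.2.1.symm,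
            h0 i j h.1, h1 i j h.1])
      exact ⟨n, fun _ => hn⟩
    · exact ⟨0, fun h' => absurd h' h⟩
  choose n hn using hn
  -- The square relation for the independent edges `uv` and `wz`, in units of `π * I`.
  have main : ∀ u v w z, u < v → w < z → u ≠ w → u ≠ z → v ≠ w → v ≠ z →
      2 * (n u v w + n w z v - n u v z - n w z u) + (σ v w + σ z v + σ u z + σ w u) = 0 := by
    intro u v w z huv hwz huw huz hvw hvz
    have sq := log_increment_square (hd u v w z huv hwz huw huz hvw hvz)
      (a := A u v w) (b := A w z v) (c := A u v z) (d := A w z u)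
      (fun t => by rw [hA u v w ⟨huv, huw.symm, hvw.symm⟩, h0 w z hwz])
      (fun t => by rw [hA w z v ⟨hwz, hvw, hvz⟩, h1 u v huv])
      (fun t => by rw [hA u v z ⟨huv, huz.symm, hvz.symm⟩, h1 w z hwz])
      (fun t => by rw [hA w z u ⟨hwz, huw, huz⟩, h0 u v huv])
    rw [hn u v w ⟨huv, huw.symm, hvw.symm⟩, hn w z v ⟨hwz, hvw, hvz⟩,
      hn u v z ⟨huv, huz.symm, hvz.symm⟩, hn w z u ⟨hwz, huw, huz⟩] at sq
    have hne : (Real.pi : ℂ) * I ≠ 0 := by simp [Real.pi_ne_zero]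
    have e1 := hσ v w hvw
    have e2 := hσ z v hvz.symm
    have e3 := hσ u z huz
    have e4 := hσ w u huw.symm
    have : ((2 * (n u v w + n w z v - n u v z - n w z u) + (σ v w + σ z v + σ u z + σ w u) : ℤ) : ℂ)
        * (Real.pi * I) = 0 := by
      push_cast
      linear_combination sq - e1 - e2 - e3 - e4
    exact_mod_cast (mul_eq_zero.1 this).resolve_right hne
  -- These are the 15 pairs of independent edges. The sum of the signs is 2 if the endpoints of the
  -- two edges alternate and 0 otherwise, and each of the five sets of four vertices has one
  -- alternating pair. Each integer `n i j w` occurs in exactly two equations with coefficients ±2,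
  -- so the sum of all equations would give 10 ≡ 0 mod 4.
  have a1 := main 0 1 2 3 (by decide) (by decide) (by decide) (by decide) (by decide) (by decide)
  have a2 := main 0 1 2 4 (by decide) (by decide) (by decide) (by decide) (by decide) (by decide)
  have a3 := main 0 1 3 4 (by decide) (by decide) (by decide) (by decide) (by decide) (by decide)
  have a4 := main 0 2 1 3 (by decide) (by decide) (by decide) (by decide) (by decide) (by decide)
  have a5 := main 0 2 1 4 (by decide) (by decide) (by decide) (by decide) (by decide) (by decide)
  have a6 := main 0 2 3 4 (by decide) (by decide) (by decide) (by decide) (by decide) (by decide)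
  have a7 := main 0 3 1 2 (by decide) (by decide) (by decide) (by decide) (by decide) (by decide)
  have a8 := main 0 3 1 4 (by decide) (by decide) (by decide) (by decide) (by decide) (by decide)
  have a9 := main 0 3 2 4 (by decide) (by decide) (by decide) (by decide) (by decide) (by decide)
  have a10 := main 0 4 1 2 (by decide) (by decide) (by decide) (by decide) (by decide) (by decide)
  have a11 := main 0 4 1 3 (by decide) (by decide) (by decide) (by decide) (by decide) (by decide)
  have a12 := main 0 4 2 3 (by decide) (by decide) (by decide) (by decide) (by decide) (by decide)
  have a13 := main 1 2 3 4 (by decide) (by decide) (by decide) (by decide) (by decide) (by decide)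
  have a14 := main 1 3 2 4 (by decide) (by decide) (by decide) (by decide) (by decide) (by decide)
  have a15 := main 1 4 2 3 (by decide) (by decide) (by decide) (by decide) (by decide) (by decide)
  simp [σ] at a1 a2 a3 a4 a5 a6 a7 a8 a9 a10 a11 a12 a13 a14 a15
  omega

open Complex in
/-- A clique of a planar graph has at most four vertices. -/
theorem IsPlanar.not_isClique_of_injective {V : Type} {G : SimpleGraph V} (hG : IsPlanar G)
    (f : Fin 5 → V) (hf : Function.Injective f) (hadj : ∀ i j, i ≠ j → G.Adj (f i) (f j)) :
    False := by
  obtain ⟨pos, arc, hpos, -, hends, hvert, hcross⟩ := hG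
  let φ : EuclideanSpace ℝ (Fin 2) → ℂ := fun x => (x 0 : ℂ) + (x 1 : ℂ) * I
  have hφ : Function.Injective φ := by
    intro x y h
    have h0 := congrArg Complex.re h
    have h1 := congrArg Complex.im h
    simp [φ] at h0 h1
    ext i
    fin_cases i
    · exact h0
    · exact h1
  have hφc : Continuous φ := by fun_prop
  -- The arc of an edge is reversed if necessary, so that it runs from the smaller index to the
  -- larger one. The last clause records that a point which is an end of the original arc is an end
  -- of the new one.
  have harc : ∀ i j, i < j → ∃ g : C(unitInterval, EuclideanSpace ℝ (Fin 2)),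
      ∃ e : G.edgeSet, (e : Sym2 V) = s(f i, f j) ∧ g 0 = pos (f i) ∧ g 1 = pos (f j) ∧
        ∀ t, ∃ t', g t = arc e t' ∧ (t' = 0 ∨ t' = 1 → t = 0 ∨ t = 1) := by
    intro i j hij
    let e : G.edgeSet := ⟨s(f i, f j), hadj i j hij.ne⟩
    obtain ⟨u, v, huv, h0, h1⟩ := hends e
    rcases Sym2.eq_iff.1 huv with ⟨rfl, rfl⟩ | ⟨rfl, rfl⟩
    · exact ⟨arc e, e, rfl, h0, h1, fun t => ⟨t, rfl, id⟩⟩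
    · refine ⟨(arc e).comp ⟨unitInterval.symm, by fun_prop⟩, e, rfl, by simpa using h1,
        by simpa using h0, fun t => ⟨unitInterval.symm t, rfl, fun h => ?_⟩⟩
      rcases h with h | h
      · right; simpa using h
      · left; simpa using h
  have harc' : ∀ i j, ∃ g : C(unitInterval, EuclideanSpace ℝ (Fin 2)), i < j →
      ∃ e : G.edgeSet, (e : Sym2 V) = s(f i, f j) ∧ g 0 = pos (f i) ∧ g 1 = pos (f j) ∧
        ∀ t, ∃ t', g t = arc e t' ∧ (t' = 0 ∨ t' = 1 → t = 0 ∨ t = 1) := by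
    intro i j
    by_cases hij : i < j
    · obtain ⟨g, hg⟩ := harc i j hij
      exact ⟨g, fun _ => hg⟩
    · exact ⟨ContinuousMap.const _ 0, fun h => absurd h hij⟩
  choose g hg using harc'
  have hv : ∀ i j w, i < j → w ≠ i → w ≠ j → ∀ t, g i j t ≠ pos (f w) := by
    intro i j w hij hwi hwj t h
    obtain ⟨e, -, h0, h1, ht⟩ := hg i j hij
    obtain ⟨t', ht', hend⟩ := ht t
    rcases hend (hvert e t' _ (ht'.symm.trans h)) with rfl | rfl
    · exact hwi (hf (hpos (h.symm.trans h0)))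
    · exact hwj (hf (hpos (h.symm.trans h1)))
  refine not_drawable_five (fun i => φ (pos (f i))) (hφ.comp (hpos.comp hf))
    (fun i j => ⟨fun t => φ (g i j t), by fun_prop⟩) ?_ ?_ ?_ ?_
  · intro i j hij
    obtain ⟨e, -, h0, -⟩ := hg i j hij
    simp [h0]
  · intro i j hij
    obtain ⟨e, -, -, h1, -⟩ := hg i j hij
    simp [h1]
  · intro i j w hij hwi hwj t h
    exact hv i j w hij hwi hwj t (hφ h)
  · intro i j k l hij hkl hik hil hjk hjl s t h
    have h : g i j s = g k l t := hφ h
    obtain ⟨e, he, h0, h1, hs⟩ := hg i j hij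
    obtain ⟨e', he', -, -, ht⟩ := hg k l hkl
    obtain ⟨s', hs', hsend⟩ := hs s
    obtain ⟨t', ht', -⟩ := ht t
    have hne : e ≠ e' := by
      rintro rfl
      rcases Sym2.eq_iff.1 (he.symm.trans he') with ⟨h, -⟩ | ⟨h, -⟩
      · exact hik (hf h)
      · exact hil (hf h)
    -- A common point of the two arcs is an end of the first, hence a vertex that is not an end of
    -- the second edge, and the second arc cannot pass through it.
    rcases hsend (hcross e e' hne s' t' (by rw [← hs', ← ht', h])).1 with rfl | rfl
    · exact hv k l i hkl hik hil t (h.symm.trans h0)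
    · exact hv k l j hkl hjk hjl t (h.symm.trans h1)

theorem IsPlanar.ncard_clique_le {V : Type} [Fintype V] {G : SimpleGraph V} (hG : IsPlanar G)
    {s : Set V} (hs : G.IsClique s) : s.ncard ≤ 4 := by
  by_contra! h
  have : Fintype s := Fintype.ofFinite s
  rw [← Nat.card_coe_set_eq, Nat.card_eq_fintype_card] at h
  obtain ⟨f⟩ := Function.Embedding.nonempty_of_card_le
    (α := Fin 5) (β := s) (by rw [Fintype.card_fin]; exact h)
  exact hG.not_isClique_of_injective (fun i => (f i : V)) (Subtype.val_injective.comp f.injective)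
    fun i j hij => hs (f i).2 (f j).2 fun h => hij (f.injective (Subtype.ext h))

/-! ### Numbers of maximal cliques -/

/-- A nonempty set of at most `k` elements is the range of a family indexed by `Fin k`. -/
theorem exists_range_eq_of_ncard_le {α : Type} [Finite α] {s : Set α} {k : ℕ} (hs : s.Nonempty)
    (h : s.ncard ≤ k) : ∃ f : Fin k → α, Set.range f = s := by
  obtain ⟨a, ha⟩ := hs
  have : Fintype s := Fintype.ofFinite s
  rw [← Nat.card_coe_set_eq, Nat.card_eq_fintype_card] at h
  obtain ⟨g⟩ := Function.Embedding.nonempty_of_card_le (α := s) (β := Fin k) (by simpa using h)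
  have : Nonempty s := ⟨⟨a, ha⟩⟩
  refine ⟨fun i => (Function.invFun g i : s), ?_⟩
  ext b
  constructor
  · rintro ⟨i, rfl⟩; exact Subtype.prop _
  · intro hb
    exact ⟨g ⟨b, hb⟩, congrArg Subtype.val (Function.leftInverse_invFun g.injective ⟨b, hb⟩)⟩

/-- A nonempty clique is the range of a map from `Fin 4`, because it has at most four vertices. The
summand 1 is for the empty set, which is maximal only if there are no vertices. -/
theorem IsPlanar.numMaximalCliques_le {V : Type} [Fintype V] {G : SimpleGraph V}
    (hG : IsPlanar G) : numMaximalCliques G ≤ Fintype.card V ^ 4 + 1 := by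
  have hsub : {s : Set V | Maximal G.IsClique s} ⊆
      insert ∅ (Set.range fun f : Fin 4 → V => Set.range f) := by
    intro s hs
    rcases s.eq_empty_or_nonempty with rfl | hne
    · exact Set.mem_insert _ _
    · exact Set.mem_insert_of_mem _
        (exists_range_eq_of_ncard_le hne (hG.ncard_clique_le hs.1))
  calc numMaximalCliques G ≤ _ := Set.ncard_le_ncard hsub (Set.toFinite _)
    _ ≤ _ := Set.ncard_insert_le _ _
    _ ≤ _ := by
        gcongr
        rw [← Set.image_univ]
        refine (Set.ncard_image_le (Set.toFinite _)).trans ?_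
        simp [Set.ncard_univ, Nat.card_eq_fintype_card]

/-- Two nonadjacent vertices of a chordal graph have pairwise adjacent common neighbours. -/
theorem IsChordal.adj_of_common_neighbors {V : Type} {G : SimpleGraph V} (hG : IsChordal G)
    {v w a b : V} (hvw : v ≠ w) (hnadj : ¬G.Adj v w) (hab : a ≠ b) (hva : G.Adj v a)
    (hwa : G.Adj w a) (hvb : G.Adj v b) (hwb : G.Adj w b) : G.Adj a b := by
  by_contra hnab
  -- If `a` and `b` were not adjacent, the four-cycle `v a w b` would have no chord. This is the
  -- only way in which chordality enters the bound.
  let c : G.Walk v v := .cons hva (.cons hwa.symm (.cons hwb (.cons hvb.symm .nil)))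
  have hc : c.IsCycle := by
    have h1 := hva.ne; have h2 := hwa.ne; have h3 := hvb.ne; have h4 := hwb.ne
    simp only [c, SimpleGraph.Walk.cons_isCycle_iff, SimpleGraph.Walk.cons_isPath_iff,
      SimpleGraph.Walk.isPath_iff_nil, SimpleGraph.Walk.support_cons,
      SimpleGraph.Walk.support_nil, SimpleGraph.Walk.edges_cons, SimpleGraph.Walk.edges_nil,
      List.mem_cons, List.not_mem_nil, Sym2.eq_iff]
    grind
  obtain ⟨x, hx, y, hy, hxy, hne⟩ := hG v c hc (by simp [c])
  have e1 := hnadj; have e2 := hnab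
  have e3 := fun h : G.Adj w v => hnadj h.symm; have e4 := fun h : G.Adj b a => hnab h.symm
  simp only [c, SimpleGraph.Walk.support_cons, SimpleGraph.Walk.support_nil,
    SimpleGraph.Walk.edges_cons, SimpleGraph.Walk.edges_nil, List.mem_cons, List.not_mem_nil,
    Sym2.eq_iff, or_false, not_or] at hx hy hne
  have := hxy.ne
  rcases hx with rfl | rfl | rfl | rfl | rfl <;> rcases hy with rfl | rfl | rfl | rfl | rfl <;>
    simp_all

/-- The number of maximal cliques of a chordal graph within a set of vertices. -/
theorem IsChordal.ncard_maximal_cliques_within_le {V : Type} [Finite V] {G : SimpleGraph V}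
    (hG : IsChordal G) (S : Finset V) :
    {s : Set V | Maximal (fun s : Set V => s ⊆ S ∧ G.IsClique s) s}.ncard ≤ S.card ^ 2 + 1 := by
  classical
  induction S using Finset.induction_on with
  | empty =>
    refine (Set.ncard_le_ncard (t := {∅}) ?_ (Set.toFinite _)).trans (by simp)
    intro s hs
    simpa using hs.1.1
  | insert v S hv ih =>
    let A : Set (Set V) := {s | Maximal (fun s : Set V => s ⊆ S ∧ G.IsClique s) s}
    let M : Set (Set V) := {s | Maximal (fun s : Set V => s ⊆ (insert v S : Finset V) ∧ G.IsClique s) s}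
    let N : Set (Set V) :=
      (fun w => insert v {u | G.Adj v u ∧ G.Adj w u ∧ u ∈ S}) '' (S : Set V)
    -- A maximal clique `s` either stays maximal in `S` after removal of `v`, or is determined by a
    -- vertex `w` of `S`: it then consists of `v` and the common neighbours of `v` and `w` in `S`.
    have hsplit : M ⊆ {s | s ∈ M ∧ s \ {v} ∈ A} ∪ N := by
      intro s hs
      by_cases hA : s \ {v} ∈ A
      · exact Or.inl ⟨hs, hA⟩
      right
      have hsub : s \ {v} ⊆ S := by
        intro u hu
        have := hs.1.1 hu.1
        simp only [Finset.coe_insert, Set.mem_insert_iff, Finset.mem_coe] at this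
        exact this.resolve_left hu.2
      have hcl : G.IsClique (s \ {v}) := hs.1.2.subset Set.sdiff_subset
      obtain ⟨t, ⟨htS, htc⟩, hst, hts⟩ : ∃ t, (t ⊆ (S : Set V) ∧ G.IsClique t) ∧ s \ {v} ⊆ t ∧
          ¬ t ⊆ s \ {v} := by
        by_contra! hcon
        exact hA ⟨⟨hsub, hcl⟩, fun t ht h => hcon t ht h⟩
      have hvs : v ∈ s := by
        by_contra hvs
        rw [Set.sdiff_singleton_eq_self hvs] at hst hts
        exact hts (hs.2 ⟨htS.trans (by simp), htc⟩ hst)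
      obtain ⟨w, hwt, hws⟩ := Set.not_subset.1 hts
      have hwS : w ∈ S := htS hwt
      have hwv : w ≠ v := by rintro rfl; exact hv hwS
      have hadjw : ∀ u ∈ s \ {v}, G.Adj w u := fun u hu => htc hwt (hst hu) (by
        rintro rfl; exact hws hu)
      -- The vertex `w` is adjacent to all of `s \ {v}`. If it were adjacent to `v` too, it could be
      -- added to `s`.
      have hnadj : ¬ G.Adj v w := by
        intro hvw
        have : insert w s ≤ s := hs.2 ⟨Set.insert_subset (by simp [hwS]) hs.1.1,
          hs.1.2.insert fun u hu hwu => ?_⟩ (Set.subset_insert _ _)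
        · exact hws ⟨this (Set.mem_insert _ _), by simpa using hwv⟩
        · by_cases huv : u = v
          · rw [huv]; exact hvw.symm
          · exact hadjw u ⟨hu, by simpa using huv⟩
      refine ⟨w, hwS, ?_⟩
      have h1 : s ⊆ insert v {u | G.Adj v u ∧ G.Adj w u ∧ u ∈ S} := by
        intro u hu
        by_cases huv : u = v
        · exact Or.inl huv
        · have hu' : u ∈ s \ {v} := ⟨hu, by simpa using huv⟩
          exact Or.inr ⟨hs.1.2 hvs hu (Ne.symm huv), hadjw u hu', hsub hu'⟩
      refine Set.Subset.antisymm (hs.2 ⟨?_, ?_⟩ h1) h1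
      · refine Set.insert_subset (by simp) fun u hu => ?_
        simp [hu.2.2]
      · refine SimpleGraph.IsClique.insert ?_ fun u hu _ => hu.1
        intro a ha b hb hab
        -- The common neighbours of the nonadjacent vertices `v` and `w` form a clique, so by
        -- maximality `s` contains all of them that lie in `S`.
        exact hG.adj_of_common_neighbors hwv.symm hnadj hab ha.1 ha.2.1 hb.1 hb.2.1
    have hfirst : {s | s ∈ M ∧ s \ {v} ∈ A}.ncard ≤ A.ncard := by
      refine Set.ncard_le_ncard_of_injOn (fun s => s \ {v}) (fun s hs => hs.2) ?_ (Set.toFinite _)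
      intro s hs t ht hst
      simp only at hst
      -- If `v` is not in `t`, then `t` is a subset of `s` and its maximality gives equality.
      have aux : ∀ s t : Set V, s ∈ M → t ∈ M → s \ {v} = t \ {v} → s ⊆ t := by
        intro s t hs ht hst
        by_cases hvt : v ∈ t
        · intro u hu
          by_cases huv : u = v
          · rwa [huv]
          · have : u ∈ s \ {v} := ⟨hu, by simpa using huv⟩
            rw [hst] at this
            exact this.1
        · refine ht.2 hs.1 ?_
          rw [Set.sdiff_singleton_eq_self hvt] at hst
          rw [← hst]; exact Set.sdiff_subset
      exact Set.Subset.antisymm (aux s t hs.1 ht.1 hst) (aux t s ht.1 hs.1 hst.symm)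
    have hN : N.ncard ≤ S.card := by
      refine (Set.ncard_image_le (Set.toFinite _)).trans ?_
      rw [Set.ncard_coe_finset]
    have := (Set.ncard_le_ncard hsplit (Set.toFinite _)).trans (Set.ncard_union_le _ _)
    rw [Finset.card_insert_of_notMem hv]
    change M.ncard ≤ _
    have ih : A.ncard ≤ S.card ^ 2 + 1 := ih
    nlinarith

theorem IsChordal.numMaximalCliques_le {V : Type} [Fintype V] {G : SimpleGraph V}
    (hG : IsChordal G) : numMaximalCliques G ≤ Fintype.card V ^ 2 + 1 := by
  simpa [numMaximalCliques] using hG.ncard_maximal_cliques_within_le Finset.univ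

/-! ### Reasoning about programs -/

/-- Sequential composition of programs. -/
infixr:60 " ⨾ " => Prog.seq

/-- The program halts within `B` steps, with the given final store. -/
def Runs (O : Language Bool) (P : Prog) (s : Store) (B : ℕ) (s' : Store) : Prop :=
  ∃ t ≤ B, Run O P s t s'

namespace Runs
variable {O : Language Bool} {P Q R : Prog} {s s' s'' : Store} {B B' : ℕ} {r : ℕ}

theorem mono (h : Runs O P s B s') (hB : B ≤ B') : Runs O P s B' s' := by
  obtain ⟨t, ht, hr⟩ := h
  exact ⟨t, ht.trans hB, hr⟩

theorem seq (h : Runs O P s B s') (h' : Runs O Q s' B' s'') : Runs O (P ⨾ Q) s (B + B') s'' := by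
  obtain ⟨t, ht, hr⟩ := h
  obtain ⟨t', ht', hr'⟩ := h'
  exact ⟨t + t', by omega, .seq hr hr'⟩

theorem loop_nil (h : s r = []) : Runs O (.loop r P) s 1 s := ⟨1, le_rfl, .loop_nil h⟩

theorem loop_cons (h : s r ≠ []) (hP : Runs O P s B s') (hL : Runs O (.loop r P) s' B' s'') :
    Runs O (.loop r P) s (B + B' + 1) s'' := by
  obtain ⟨t, ht, hr⟩ := hP
  obtain ⟨t', ht', hr'⟩ := hL
  exact ⟨t + t' + 1, by omega, .loop_cons h hr hr'⟩

end Runs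

/-! ### Symbolic execution of loop-free programs -/

/-- The store with finitely many nonempty stacks given by a list. -/
def st (l : List (List Bool)) : Store := fun r => l.getD r []

theorem st_set (l : List (List Bool)) {r : ℕ} (h : r < l.length) (v : List Bool) :
    Function.update (st l) r v = st (l.set r v) := by
  funext i
  rcases eq_or_ne i r with rfl | hi
  · simp [st, h]
  · simp [st, Function.update_of_ne hi, List.getElem?_set_ne hi.symm]

/-- Programs without loops and queries that use only stacks with numbers below `n`. -/
def Prog.simple (n : ℕ) : Prog → Bool
  | .skip => true
  | .push r _ => decide (r < n)
  | .pop r => decide (r < n)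
  | .query _ _ => false
  | .seq P Q => P.simple n && Q.simple n
  | .branch r P Q R => decide (r < n) && (P.simple n && (Q.simple n && R.simple n))
  | .loop _ _ => false

/-- The effect of a simple program. -/
def Prog.exec : Prog → List (List Bool) → List (List Bool)
  | .skip, l => l
  | .push r b, l => l.set r (b :: l.getD r [])
  | .pop r, l => l.set r (l.getD r []).tail
  | .query _ _, l => l
  | .seq P Q, l => Q.exec (P.exec l)
  | .branch r P Q R, l =>
    match l.getD r [] with
    | [] => P.exec l
    | false :: _ => Q.exec l
    | true :: _ => R.exec l
  | .loop _ _, l => l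

/-- A bound for the number of steps of a simple program. -/
def Prog.cost : Prog → ℕ
  | .seq P Q => P.cost + Q.cost
  | .branch _ P Q R => P.cost + Q.cost + R.cost + 1
  | _ => 1

theorem Prog.length_exec (P : Prog) (l : List (List Bool)) : (P.exec l).length = l.length := by
  induction P generalizing l with
  | seq P Q hP hQ => simp [exec, hP, hQ]
  | branch r P Q R hP hQ hR => simp only [exec]; split <;> simp [*]
  | _ => simp [exec]

/-- Runs of straight-line code are reduced to evaluating `Prog.exec` on an explicit list of stacks.
Only loops and queries then need arguments of their own. -/
theorem Prog.runs_exec (O : Language Bool) (P : Prog) (l : List (List Bool))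
    (h : P.simple l.length = true) : Runs O P (st l) P.cost (st (P.exec l)) := by
  induction P generalizing l with
  | skip => exact ⟨1, le_rfl, .skip _⟩
  | push r b =>
    have h : r < l.length := by simpa [simple] using h
    refine ⟨1, le_rfl, ?_⟩
    rw [exec, ← st_set _ h]
    exact .push _ _ _
  | pop r =>
    have h : r < l.length := by simpa [simple] using h
    refine ⟨1, le_rfl, ?_⟩
    rw [exec, ← st_set _ h]
    exact .pop _ _
  | query => simp [simple] at h
  | seq P Q hP hQ =>
    rw [simple, Bool.and_eq_true] at h
    exact (hP l h.1).seq (hQ _ (by rw [length_exec]; exact h.2))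
  | branch r P Q R hP hQ hR =>
    simp only [simple, Bool.and_eq_true] at h
    simp only [exec, cost]
    split
    · next hl =>
      obtain ⟨t, ht, hr⟩ := hP l h.2.1
      exact ⟨t + 1, by omega, .branch_nil hl hr⟩
    · next hl =>
      obtain ⟨t, ht, hr⟩ := hQ l h.2.2.1
      exact ⟨t + 1, by omega, .branch_false (by simp only [st, hl, List.head?_cons]) hr⟩
    · next hl =>
      obtain ⟨t, ht, hr⟩ := hR l h.2.2.2
      exact ⟨t + 1, by omega, .branch_true (by simp only [st, hl, List.head?_cons]) hr⟩
  | loop => simp [simple] at h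

theorem Runs.exec {O : Language Bool} {P : Prog} {l l' : List (List Bool)} {n : ℕ}
    (h : P.simple n = true) (hn : l.length = n) (h' : P.exec l = l') :
    Runs O P (st l) P.cost (st l') :=
  h' ▸ P.runs_exec O l (hn ▸ h)

theorem Runs.to {O : Language Bool} {P : Prog} {s : Store} {B : ℕ} {l l' : List (List Bool)}
    (h : Runs O P s B (st l)) (hl : l = l') : Runs O P s B (st l') := hl ▸ h

theorem Runs.loop_done {O : Language Bool} {P : Prog} {r B : ℕ} {l l' : List (List Bool)}
    (h : l.getD r [] = []) (hl : l = l') (hB : 1 ≤ B) :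
    Runs O (.loop r P) (st l) B (st l') := ((Runs.loop_nil h).to hl).mono hB

theorem Runs.loop_step {O : Language Bool} {P : Prog} {r n B B' : ℕ} {l l' : List (List Bool)}
    {s : Store} (h : P.simple n = true) (hn : l.length = n) (hr : l.getD r [] ≠ [])
    (h' : P.exec l = l') (hL : Runs O (.loop r P) (st l') B s) (hB : P.cost + B + 1 ≤ B') :
    Runs O (.loop r P) (st l) B' s :=
  (Runs.loop_cons hr (Runs.exec h hn h') hL).mono hB

/-- Remove the top of a stack and go on with a program that depends on it (`false` if the stack was
empty). -/
def readBit (r : ℕ) (k : Bool → Prog) : Prog :=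
  .branch r (.pop r ⨾ k false) (.pop r ⨾ k false) (.pop r ⨾ k true)

@[simp] theorem exec_readBit (r : ℕ) (k : Bool → Prog) (l : List (List Bool)) :
    (readBit r k).exec l =
      (k ((l.getD r []).headD false)).exec (l.set r (l.getD r []).tail) := by
  simp only [readBit, Prog.exec]
  split <;> simp_all

theorem Runs.readBit {O : Language Bool} {r : ℕ} {k : Bool → Prog} {l : List (List Bool)} {B : ℕ}
    {s : Store} (hr : r < l.length) (h : Runs O (k ((l.getD r []).headD false))
      (st (l.set r (l.getD r []).tail)) B s) :
    Runs O (BoolSynth.readBit r k) (st l) (B + 2) s := by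
  have hpop : Run O (.pop r) (st l) 1 (st (l.set r (l.getD r []).tail)) := by
    rw [← st_set _ hr]; exact .pop _ _
  obtain ⟨t, ht, hR⟩ := h
  rcases hl : l.getD r [] with _ | ⟨_ | _, v⟩ <;> rw [hl] at hpop hR
  · exact ⟨1 + t + 1, by omega, .branch_nil (by exact hl) (.seq hpop hR)⟩
  · exact ⟨1 + t + 1, by omega, .branch_false (by simp only [st, hl, List.head?_cons])
      (.seq hpop hR)⟩
  · exact ⟨1 + t + 1, by omega, .branch_true (by simp only [st, hl, List.head?_cons])
      (.seq hpop hR)⟩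

/-- Replace the top of a stack by `true`. -/
def setTrue (r : ℕ) : Prog := .pop r ⨾ .push r true

/-- Move the content of stack `a` to stack `b`, which reverses it. -/
def move (a b : ℕ) : Prog := .loop a (readBit a fun x => .push b x)

theorem runs_move (O : Language Bool) {a b : ℕ} (l : List (List Bool)) (ha : a < l.length)
    (hb : b < l.length) (hab : a ≠ b) {l' : List (List Bool)}
    (h : (l.set b ((l.getD a []).reverse ++ l.getD b [])).set a [] = l') :
    Runs O (move a b) (st l) (8 * (l.getD a []).length + 1) (st l') := by
  subst h
  generalize hv : l.getD a [] = v
  induction v generalizing l with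
  | nil =>
    have : st ((l.set b ([].reverse ++ l.getD b [])).set a []) = st l := by
      rw [← st_set _ (by simpa using ha), ← st_set _ hb]
      funext i
      simp only [Function.update_apply]
      split_ifs with h1 h2
      · rw [h1, st, hv]
      · rw [h2]; rfl
      · rfl
    rw [this]
    exact (Runs.loop_nil hv).mono (by simp)
  | cons x v ih =>
    have hbody : Runs O (readBit a fun x => .push b x) (st l)
        7 (st ((l.set a v).set b (x :: l.getD b []))) :=
      (Runs.exec (by simp [readBit, Prog.simple, ha, hb]) rfl (by
        rw [exec_readBit, hv]
        simp [Prog.exec, List.getElem?_set_ne hab])).mono (by simp [readBit, Prog.cost])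
    have hrec := ih ((l.set a v).set b (x :: l.getD b [])) (by simpa using ha) (by simpa using hb)
      (by rw [List.set_comm _ _ hab, List.getD_eq_getElem?_getD,
        List.getElem?_set_self (by simpa using ha), Option.getD_some])
    have heq : (((l.set a v).set b (x :: l.getD b [])).set b
        (v.reverse ++ ((l.set a v).set b (x :: l.getD b [])).getD b [])).set a [] =
        (l.set b ((x :: v).reverse ++ l.getD b [])).set a [] := by
      simp only [List.getD_eq_getElem?_getD, List.set_set, List.reverse_cons, List.append_assoc]
      rw [List.getElem?_set_self (by simpa using hb), List.set_comm _ _ hab, List.set_set]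
      simp
    rw [heq] at hrec
    exact (Runs.loop_cons (by change l.getD a [] ≠ []; rw [hv]; simp) hbody hrec).mono
      (by simp only [List.length_cons]; omega)

/-! ### The verifier

The stacks are: 0 the query, 1 the certificate, 2 the prefix of the output, 3 the inputs,
4 the outputs, 5 a temporary stack, 6 and 7 the new block (reversed, and in order), 8 a flag of a
loop, 9 the rejection flag, 10 the mask bit, 11 the flag of an outer loop. -/

/-- While the top of stack `0` is `true`, remove it and move a bit from stack `src` to `dst`. Stop
after removing a `false`. -/
def readBody (src dst : ℕ) : Prog :=
  readBit 0 fun c => if c then readBit src fun b => .push dst b else .pop 11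

/-- Move bits from stack `src` to `dst`, one for each leading `true` of stack `0`. -/
def readLoop (src dst : ℕ) : Prog :=
  .push 11 true ⨾ .loop 11 (readBody src dst)

/-- The effect of `readLoop 0 dst` on the stacks `0` and `dst`. -/
def decodeBits : List Bool → List Bool → List Bool × List Bool
  | [], P => ([], P)
  | [true], P => ([], false :: P)
  | true :: b :: Q, P => decodeBits Q (b :: P)
  | false :: Q, P => (Q, P)

/-- The effect of `readLoop src dst` on the stacks `0`, `src` and `dst`. -/
def readUnary : List Bool → List Bool → List Bool → List Bool × List Bool × List Bool
  | [], C, X => ([], C, X)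
  | false :: Q, C, X => (Q, C, X)
  | true :: Q, C, X => readUnary Q C.tail (C.headD false :: X)

theorem simple_readBody {src dst : ℕ} (hs : src < 12) (hd : dst < 12) :
    (readBody src dst).simple 12 = true := by
  simp [readBody, readBit, Prog.simple, hs, hd]

theorem cost_readBody (src dst : ℕ) : (readBody src dst).cost = 13 := by
  simp [readBody, readBit, Prog.cost]

theorem runs_readLoop {O : Language Bool} {src dst B : ℕ} {l : List (List Bool)} {s : Store}
    (hl : l.length = 12) (h : Runs O (.loop 11 (readBody src dst))
      (st (l.set 11 (true :: l.getD 11 []))) B s) :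
    Runs O (readLoop src dst) (st l) (B + 1) s :=
  ((Runs.exec (n := 12) (P := .push 11 true) (by simp [Prog.simple]) hl rfl).seq h).mono
    (by simp only [Prog.cost]; omega)

section Programs

variable (O : Language Bool)

theorem runs_decodeBits (Q P a1 a3 a4 a5 a6 a7 a8 a9 a10 : List Bool) :
    Runs O (readLoop 0 2) (st [Q, a1, P, a3, a4, a5, a6, a7, a8, a9, a10, []])
      (14 * Q.length + 30)
      (st [(decodeBits Q P).1, a1, (decodeBits Q P).2, a3, a4, a5, a6, a7, a8, a9, a10, []]) := by
  refine (runs_readLoop (B := 14 * Q.length + 29) rfl ?_).mono le_rfl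
  have hs : (readBody 0 2).simple 12 = true := simple_readBody (by simp) (by simp)
  have hc := cost_readBody 0 2
  induction Q, P using decodeBits.induct with
  | case1 P =>
    exact Runs.loop_step hs rfl (by simp) (by simp [readBody, Prog.exec]; rfl)
      (Runs.loop_done (B := 1) (by simp) (by simp [decodeBits]) (by simp)) (by rw [hc]; simp)
  | case2 P =>
    -- A lone final `true` is followed by the default bit `false`. The loop needs one more round, on
    -- the empty stack, to lower its flag.
    exact Runs.loop_step (B := 15) hs rfl (by simp) (by simp [readBody, Prog.exec]; rfl)
      (Runs.loop_step hs rfl (by simp) (by simp [readBody, Prog.exec]; rfl)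
      (Runs.loop_done (B := 1) (by simp) (by simp [decodeBits]) (by simp)) (by rw [hc]))
      (by rw [hc]; simp)
  | case3 P b Q ih =>
    exact Runs.loop_step hs rfl (by simp) (by simp [readBody, Prog.exec])
      (ih.to (by simp [decodeBits])) (by rw [hc]; simp; omega)
  | case4 Q P =>
    exact Runs.loop_step hs rfl (by simp) (by simp [readBody, Prog.exec]; rfl)
      (Runs.loop_done (B := 1) (by simp) (by simp [decodeBits]) (by simp)) (by rw [hc]; simp)

theorem runs_readUnary_inputs (Q C X a2 a4 a5 a6 a7 a8 a9 a10 : List Bool) :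
    Runs O (readLoop 1 3) (st [Q, C, a2, X, a4, a5, a6, a7, a8, a9, a10, []])
      (14 * Q.length + 30)
      (st [(readUnary Q C X).1, (readUnary Q C X).2.1, a2, (readUnary Q C X).2.2,
        a4, a5, a6, a7, a8, a9, a10, []]) := by
  refine (runs_readLoop (B := 14 * Q.length + 29) rfl ?_).mono le_rfl
  have hs : (readBody 1 3).simple 12 = true := simple_readBody (by simp) (by simp)
  have hc := cost_readBody 1 3
  induction Q, C, X using readUnary.induct with
  | case1 | case2 =>
    exact Runs.loop_step hs rfl (by simp) (by simp [readBody, Prog.exec]; rfl)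
      (Runs.loop_done (B := 1) (by simp) (by simp [readUnary]) (by simp)) (by rw [hc]; simp)
  | case3 C X Q ih =>
    exact Runs.loop_step hs rfl (by simp) (by simp [readBody, Prog.exec])
      (ih.to (by simp [readUnary])) (by rw [hc]; simp; omega)

theorem runs_readUnary_outputs (Q C Y a2 a3 a5 a6 a7 a8 a9 a10 : List Bool) :
    Runs O (readLoop 1 4) (st [Q, C, a2, a3, Y, a5, a6, a7, a8, a9, a10, []])
      (14 * Q.length + 30)
      (st [(readUnary Q C Y).1, (readUnary Q C Y).2.1, a2, a3, (readUnary Q C Y).2.2,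
        a5, a6, a7, a8, a9, a10, []]) := by
  refine (runs_readLoop (B := 14 * Q.length + 29) rfl ?_).mono le_rfl
  have hs : (readBody 1 4).simple 12 = true := simple_readBody (by simp) (by simp)
  have hc := cost_readBody 1 4
  induction Q, C, Y using readUnary.induct with
  | case1 | case2 =>
    exact Runs.loop_step hs rfl (by simp) (by simp [readBody, Prog.exec]; rfl)
      (Runs.loop_done (B := 1) (by simp) (by simp [readUnary]) (by simp)) (by rw [hc]; simp)
  | case3 C Y Q ih =>
    exact Runs.loop_step hs rfl (by simp) (by simp [readBody, Prog.exec])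
      (ih.to (by simp [readUnary])) (by rw [hc]; simp; omega)

/-- Read a bit of the input (stack 3) and two bits of the clause (stack 0): copy them or, if the
clause is masked, write `true` twice, and raise the flag if the assignment satisfies a literal. -/
def inputBody : Prog :=
  readBit 3 fun x => readBit 0 fun p => readBit 0 fun n => readBit 10 fun g =>
    .push 10 g ⨾ .push 5 x ⨾ .push 6 (g || p) ⨾ .push 6 (g || n) ⨾
      if (if x then p else n) then setTrue 8 else .skip

/-- Read a bit of the output (stack 4) and two bits of the clause (stack 0), and raise the flag if
the assignment satisfies a literal. -/
def outputBody : Prog :=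
  readBit 4 fun y => readBit 0 fun p => readBit 0 fun n =>
    .push 5 y ⨾ if (if y then p else n) then setTrue 8 else .skip

/-- Read a bit of the new block and a bit of an earlier block, and raise the flag if the first one is
greater. -/
def compareBody : Prog :=
  readBit 7 fun b => readBit 2 fun p => .push 5 b ⨾ if b && !p then setTrue 8 else .skip

/-- Skip a bit of an earlier block for each bit of the output. -/
def skipBody : Prog := readBit 4 fun b => .pop 2 ⨾ .push 5 b

/-- Reject if the next bit of the prefix differs from the next bit of the new block. -/
def prefixBody (a : ℕ) : Prog :=
  readBit a fun b => .branch 2 .skip (.pop 2 ⨾ if b then setTrue 9 else .skip)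
    (.pop 2 ⨾ if b then .skip else setTrue 9)

/-! ### The functions computed by the inner loops of the verifier -/

/-- The assignment `X` satisfies a literal of the clause at the beginning of `Q`. -/
def hit : List Bool → List Bool → Bool
  | [], _ => false
  | x :: X, Q => (if x then Q.headD false else Q.tail.headD false) || hit X Q.tail.tail

/-- The bits of the clause at the beginning of `Q`, or of the full clause if `g` is `true`. -/
def maskBits (g : Bool) : List Bool → List Bool → List Bool
  | [], _ => []
  | _ :: X, Q => (g || Q.headD false) :: (g || Q.tail.headD false) :: maskBits g X Q.tail.tail

/-- Some position of the first list holds `true` and the same position of the second `false`. -/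
def exceeds : List Bool → List Bool → Bool
  | [], _ => false
  | b :: W, P => (b && !P.headD false) || exceeds W P.tail

/-- The lists differ at a position that both have. -/
def mismatch : List Bool → List Bool → Bool
  | [], _ => false
  | _, [] => false
  | b :: W, p :: P => (b != p) || mismatch W P

/-- As in the other inner loops, 1000 is a generous bound for one round; `decide` verifies that the
body costs at most 999. The case distinction on `Q` covers malformed words that end within a clause,
where missing bits are read as `false`. -/
theorem runs_inputBody (X Q Z t a1 a2 a4 a7 a9 a11 : List Bool) (h g : Bool) :
    Runs O (.loop 3 inputBody) (st [Q, a1, a2, X, a4, t, Z, a7, [h], a9, [g], a11])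
      (1000 * X.length + 1)
      (st [Q.drop (2 * X.length), a1, a2, [], a4, X.reverse ++ t, (maskBits g X Q).reverse ++ Z,
        a7, [h || hit X Q], a9, [g], a11]) := by
  have hs : inputBody.simple 12 = true := by decide
  have hc : inputBody.cost ≤ 999 := by decide
  induction X generalizing Q Z t h with
  | nil => exact Runs.loop_done rfl (by simp [maskBits, hit]) le_rfl
  | cons x X ih =>
    refine Runs.loop_step hs rfl (by simp) ?_ ((ih Q.tail.tail
      ((g || Q.tail.headD false) :: (g || Q.headD false) :: Z) (x :: t)
      (h || (if x then Q.headD false else Q.tail.headD false))).to ?_) ?_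
    · rcases Q with _ | ⟨_ | _, _ | ⟨_ | _, Q⟩⟩ <;> cases x <;>
        simp [inputBody, Prog.exec, setTrue]
    · simp [maskBits, hit, Nat.mul_add, Bool.or_assoc]
    · simp only [List.length_cons]; omega

theorem runs_outputBody (Y Q t a1 a2 a3 a6 a7 a9 a10 a11 : List Bool) (h : Bool) :
    Runs O (.loop 4 outputBody) (st [Q, a1, a2, a3, Y, t, a6, a7, [h], a9, a10, a11])
      (1000 * Y.length + 1)
      (st [Q.drop (2 * Y.length), a1, a2, a3, [], Y.reverse ++ t, a6, a7, [h || hit Y Q], a9, a10,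
        a11]) := by
  have hs : outputBody.simple 12 = true := by decide
  have hc : outputBody.cost ≤ 999 := by decide
  induction Y generalizing Q t h with
  | nil => exact Runs.loop_done rfl (by simp [hit]) le_rfl
  | cons y Y ih =>
    refine Runs.loop_step hs rfl (by simp) ?_ ((ih Q.tail.tail (y :: t)
      (h || (if y then Q.headD false else Q.tail.headD false))).to ?_) ?_
    · rcases Q with _ | ⟨_ | _, _ | ⟨_ | _, Q⟩⟩ <;> cases y <;>
        simp [outputBody, Prog.exec, setTrue]
    · simp [hit, Nat.mul_add, Bool.or_assoc]
    · simp only [List.length_cons]; omega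

theorem runs_compareBody (W P t a0 a1 a3 a4 a6 a9 a10 a11 : List Bool) (h : Bool) :
    Runs O (.loop 7 compareBody) (st [a0, a1, P, a3, a4, t, a6, W, [h], a9, a10, a11])
      (1000 * W.length + 1)
      (st [a0, a1, P.drop W.length, a3, a4, W.reverse ++ t, a6, [], [h || exceeds W P], a9, a10,
        a11]) := by
  have hs : compareBody.simple 12 = true := by decide
  have hc : compareBody.cost ≤ 999 := by decide
  induction W generalizing P t h with
  | nil => exact Runs.loop_done rfl (by simp [exceeds]) le_rfl
  | cons b W ih =>
    refine Runs.loop_step hs rfl (by simp) ?_ ((ih P.tail (b :: t)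
      (h || (b && !P.headD false))).to ?_) ?_
    · rcases P with _ | ⟨_ | _, P⟩ <;> cases b <;> simp [compareBody, Prog.exec, setTrue]
    · simp [exceeds, Bool.or_assoc]
    · simp only [List.length_cons]; omega

theorem runs_skipBody (Y P t a0 a1 a3 a6 a7 a8 a9 a10 a11 : List Bool) :
    Runs O (.loop 4 skipBody) (st [a0, a1, P, a3, Y, t, a6, a7, a8, a9, a10, a11])
      (1000 * Y.length + 1)
      (st [a0, a1, P.drop Y.length, a3, [], Y.reverse ++ t, a6, a7, a8, a9, a10, a11]) := by
  have hs : skipBody.simple 12 = true := by decide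
  have hc : skipBody.cost ≤ 999 := by decide
  induction Y generalizing P t with
  | nil => exact Runs.loop_done rfl (by simp) le_rfl
  | cons b Y ih =>
    refine Runs.loop_step hs rfl (by simp) ?_ ((ih P.tail (b :: t)).to ?_) ?_
    · simp [skipBody, Prog.exec]
    · simp
    · simp only [List.length_cons]; omega

theorem runs_prefixBody_block (W P a0 a1 a3 a4 a5 a6 a8 a10 a11 : List Bool) (h : Bool) :
    Runs O (.loop 7 (prefixBody 7)) (st [a0, a1, P, a3, a4, a5, a6, W, a8, [h], a10, a11])
      (1000 * W.length + 1)
      (st [a0, a1, P.drop W.length, a3, a4, a5, a6, [], a8, [h || mismatch W P], a10, a11]) := by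
  have hs : (prefixBody 7).simple 12 = true := by decide
  have hc : (prefixBody 7).cost ≤ 999 := by decide
  induction W generalizing P h with
  | nil => exact Runs.loop_done rfl (by simp [mismatch]) le_rfl
  | cons b W ih =>
    rcases P with _ | ⟨p, P⟩
    · refine Runs.loop_step hs rfl (by simp) ?_ ((ih [] h).to ?_) ?_
      · simp [prefixBody, Prog.exec]
      · cases W <;> simp [mismatch]
      · simp only [List.length_cons]; omega
    · refine Runs.loop_step hs rfl (by simp) ?_ ((ih P (h || (b != p))).to ?_) ?_
      · cases b <;> cases p <;> simp [prefixBody, Prog.exec, setTrue]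
      · simp [mismatch, Bool.or_assoc]
      · simp only [List.length_cons]; omega

theorem runs_prefixBody_outputs (W P a0 a1 a3 a5 a6 a7 a8 a10 a11 : List Bool) (h : Bool) :
    Runs O (.loop 4 (prefixBody 4)) (st [a0, a1, P, a3, W, a5, a6, a7, a8, [h], a10, a11])
      (1000 * W.length + 1)
      (st [a0, a1, P.drop W.length, a3, [], a5, a6, a7, a8, [h || mismatch W P], a10, a11]) := by
  have hs : (prefixBody 4).simple 12 = true := by decide
  have hc : (prefixBody 4).cost ≤ 999 := by decide
  induction W generalizing P h with
  | nil => exact Runs.loop_done rfl (by simp [mismatch]) le_rfl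
  | cons b W ih =>
    rcases P with _ | ⟨p, P⟩
    · refine Runs.loop_step hs rfl (by simp) ?_ ((ih [] h).to ?_) ?_
      · simp [prefixBody, Prog.exec]
      · cases W <;> simp [mismatch]
      · simp only [List.length_cons]; omega
    · refine Runs.loop_step hs rfl (by simp) ?_ ((ih P (h || (b != p))).to ?_) ?_
      · cases b <;> cases p <;> simp [prefixBody, Prog.exec, setTrue]
      · simp [mismatch, Bool.or_assoc]
      · simp only [List.length_cons]; omega

/-- Read the mask bit of the next clause, and write the marker of a clause if there are inputs. -/
def clauseStart : Prog :=
  readBit 1 fun g => .push 10 g ⨾ .push 8 false ⨾ .branch 3 .skip (.push 6 true) (.push 6 true)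

/-- Reject unless the mask bit tells whether the input part of the clause is false. -/
def inputCheck : Prog :=
  readBit 8 fun h => readBit 10 fun g =>
    .push 10 g ⨾ .push 8 false ⨾ if h == g then setTrue 9 else .skip

/-- Reject if the clause is masked and its output part is false. -/
def outputCheck : Prog :=
  readBit 8 fun h => readBit 10 fun g => if g && !h then setTrue 9 else .skip

/-- Process a clause of the specification. -/
def clauseBody : Prog :=
  clauseStart ⨾ .loop 3 inputBody ⨾ move 5 3 ⨾ inputCheck ⨾ .loop 4 outputBody ⨾ move 5 4 ⨾
    outputCheck

/-- Process all clauses of the specification. -/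
def clauseLoop : Prog :=
  .push 11 true ⨾ .loop 11 (readBit 0 fun c => if c then clauseBody else .pop 11)

/-- Compare the new block with an earlier block, and reject unless it is greater somewhere. -/
def blockBody : Prog :=
  (.pop 1 ⨾ .push 8 false) ⨾ .loop 7 compareBody ⨾ move 5 7 ⨾ .loop 4 skipBody ⨾ move 5 4 ⨾
    readBit 8 fun h => if h then .skip else setTrue 9

/-- The verifier of the extendability of a prefix of the output. -/
def verifier : Prog :=
  .push 9 false ⨾ readLoop 0 2 ⨾ readLoop 1 3 ⨾ readLoop 1 4 ⨾ .push 6 true ⨾ clauseLoop ⨾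
    .push 6 false ⨾ move 6 7 ⨾ .loop 1 blockBody ⨾ .branch 2 (setTrue 9) .skip .skip ⨾
    .loop 7 (prefixBody 7) ⨾ .loop 4 (prefixBody 4) ⨾
    .branch 2 .skip (setTrue 9) (setTrue 9) ⨾ readBit 9 fun r => .push 0 (!r)

/-- The marker of a clause, which is absent if there are no inputs. -/
def marker : List Bool → List Bool
  | [] => []
  | _ :: _ => [true]

/-- The rejection of a clause: the mask bit `g` does not tell whether the input part is false, or the
clause is masked and its output part is false. -/
def badClause (X Y Q : List Bool) (g : Bool) : Bool :=
  (hit X Q == g) || (g && !hit Y (Q.drop (2 * X.length)))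

/-- The effect of `clauseLoop` on the stacks `0`, `1`, `6` and `9`. -/
def readClauses (X Y : List Bool) : List Bool → List Bool → List Bool → Bool →
    List Bool × List Bool × List Bool × Bool
  | [], C, Z, r => ([], C, Z, r)
  | false :: Q, C, Z, r => (Q, C, Z, r)
  | true :: Q, C, Z, r =>
    readClauses X Y (Q.drop (2 * X.length + 2 * Y.length)) C.tail
      ((maskBits (C.headD false) X Q).reverse ++ (marker X ++ Z))
      (r || badClause X Y Q (C.headD false))
termination_by Q => Q.length
decreasing_by simp

/-- The effect of `.loop 1 blockBody` on the stacks `2` and `9`, for a new block `W` followed by `n`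
bits of output. -/
def compareBlocks (W : List Bool) (n : ℕ) : List Bool → List Bool → Bool → List Bool × Bool
  | [], P, r => (P, r)
  | _ :: C, P, r => compareBlocks W n C (P.drop (W.length + n)) (r || !exceeds W P)

/-- A clause is copied to the new block while it is being evaluated, so whether to mask it must be
known before its truth value is. The certificate supplies this bit as a guess, which is checked
after the copying. -/
theorem runs_clauseBody (Q C X Y Z a2 a7 a11 : List Bool) (r : Bool) :
    Runs O clauseBody (st [Q, C, a2, X, Y, [], Z, a7, [], [r], [], a11])
      (1500 * (X.length + Y.length + 1))
      (st [Q.drop (2 * X.length + 2 * Y.length), C.tail, a2, X, Y, [],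
        (maskBits (C.headD false) X Q).reverse ++ (marker X ++ Z), a7, [],
        [r || badClause X Y Q (C.headD false)], [], a11]) := by
  generalize hg : C.headD false = g
  have h1 : Runs O clauseStart (st [Q, C, a2, X, Y, [], Z, a7, [], [r], [], a11]) 100
      (st [Q, C.tail, a2, X, Y, [], marker X ++ Z, a7, [false], [r], [g], a11]) :=
    Runs.mono (Runs.exec (n := 12) (by decide) rfl
      (by subst hg; cases X with
        | nil => simp [clauseStart, Prog.exec, marker]
        | cons x X => cases x <;> simp [clauseStart, Prog.exec, marker])) (by decide)
  have h2 := runs_inputBody O X Q (marker X ++ Z) [] C.tail a2 Y a7 [r] a11 false g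
  have h3 := runs_move O (a := 5) (b := 3) [Q.drop (2 * X.length), C.tail, a2, [], Y,
    X.reverse ++ [], (maskBits g X Q).reverse ++ (marker X ++ Z), a7, [false || hit X Q], [r], [g],
    a11] (by simp) (by simp) (by simp) (l' := [Q.drop (2 * X.length), C.tail, a2, X, Y,
    [], (maskBits g X Q).reverse ++ (marker X ++ Z), a7, [hit X Q], [r], [g], a11]) (by simp)
  have h4 : Runs O inputCheck (st [Q.drop (2 * X.length), C.tail, a2, X, Y,
    [], (maskBits g X Q).reverse ++ (marker X ++ Z), a7, [hit X Q], [r], [g], a11]) 100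
    (st [Q.drop (2 * X.length), C.tail, a2, X, Y,
    [], (maskBits g X Q).reverse ++ (marker X ++ Z), a7, [false], [r || hit X Q == g], [g], a11]) :=
    Runs.mono (Runs.exec (n := 12) (by decide) rfl
      (by cases hit X Q <;> cases g <;> simp [inputCheck, Prog.exec, setTrue])) (by decide)
  have h5 := runs_outputBody O Y (Q.drop (2 * X.length)) [] C.tail a2 X
    ((maskBits g X Q).reverse ++ (marker X ++ Z)) a7 [r || hit X Q == g] [g] a11 false
  have h6 := runs_move O (a := 5) (b := 4) [(Q.drop (2 * X.length)).drop (2 * Y.length), C.tail, a2,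
    X, [], Y.reverse ++ [], (maskBits g X Q).reverse ++ (marker X ++ Z), a7,
    [false || hit Y (Q.drop (2 * X.length))], [r || hit X Q == g], [g],
    a11] (by simp) (by simp) (by simp) (l' := [Q.drop (2 * X.length + 2 * Y.length), C.tail, a2, X, Y,
    [], (maskBits g X Q).reverse ++ (marker X ++ Z), a7, [hit Y (Q.drop (2 * X.length))],
    [r || hit X Q == g], [g], a11]) (by simp)
  have h7 : Runs O outputCheck (st [Q.drop (2 * X.length + 2 * Y.length), C.tail, a2, X, Y,
    [], (maskBits g X Q).reverse ++ (marker X ++ Z), a7, [hit Y (Q.drop (2 * X.length))],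
    [r || hit X Q == g], [g], a11]) 100
    (st [Q.drop (2 * X.length + 2 * Y.length), C.tail, a2, X, Y,
    [], (maskBits g X Q).reverse ++ (marker X ++ Z), a7, [], [r || badClause X Y Q g], [], a11]) :=
    Runs.mono (Runs.exec (n := 12) (by decide) rfl
      (by
        unfold badClause
        generalize hit Y (Q.drop (2 * X.length)) = h
        cases h <;> cases g <;> simp [outputCheck, Prog.exec, setTrue])) (by decide)
  refine (h1.seq (h2.seq (h3.seq (h4.seq (h5.seq (h6.seq h7)))))).mono ?_
  simp
  omega

theorem runs_clauseLoop (Q C X Y Z a2 a7 : List Bool) (r : Bool) :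
    Runs O clauseLoop (st [Q, C, a2, X, Y, [], Z, a7, [], [r], [], []])
      (2000 * (X.length + Y.length + 1) * (Q.length + 1))
      (st [(readClauses X Y Q C Z r).1, (readClauses X Y Q C Z r).2.1, a2, X, Y, [],
        (readClauses X Y Q C Z r).2.2.1, a7, [], [(readClauses X Y Q C Z r).2.2.2], [], []]) := by
  suffices h : Runs O (.loop 11 (readBit 0 fun c => if c then clauseBody else .pop 11))
      (st [Q, C, a2, X, Y, [], Z, a7, [], [r], [], [true]])
      ((1500 * (X.length + Y.length + 1) + 100) * Q.length + 100)
      (st [(readClauses X Y Q C Z r).1, (readClauses X Y Q C Z r).2.1, a2, X, Y, [],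
        (readClauses X Y Q C Z r).2.2.1, a7, [], [(readClauses X Y Q C Z r).2.2.2], [], []]) by
    refine ((Runs.exec (n := 12) (by decide) rfl (by simp [Prog.exec])).seq h).mono ?_
    simp only [Prog.cost]
    nlinarith
  have hpop : ∀ l l' : List (List Bool), l.length = 12 → l.set 11 (l.getD 11 []).tail = l' →
      Runs O (.pop 11) (st l) 1 (st l') := fun l l' hl h => Runs.exec (n := 12) (by decide) hl h
  induction Q, C, Z, r using readClauses.induct X Y with
  | case1 C Z r =>
    refine (Runs.loop_cons (by simp [st]) (Runs.readBit (by simp) (hpop _ _ rfl rfl))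
      (Runs.loop_done (B := 1) (by simp) (by simp [readClauses]) le_rfl)).mono (by simp)
  | case2 Q C Z r =>
    refine (Runs.loop_cons (by simp [st]) (Runs.readBit (by simp) (hpop _ _ rfl rfl))
      (Runs.loop_done (B := 1) (by simp) (by simp [readClauses]) le_rfl)).mono (by simp)
  | case3 Q C Z r ih =>
    refine (Runs.loop_cons (by simp [st]) (Runs.readBit (by simp)
      (runs_clauseBody O Q C X Y Z a2 a7 [true] r)) (ih.to (by rw [readClauses]))).mono ?_
    have : (Q.drop (2 * X.length + 2 * Y.length)).length ≤ Q.length := by simp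
    simp only [List.length_cons]
    nlinarith

theorem runs_blockBody (C P Y W a0 a3 a6 a10 a11 : List Bool) (c r : Bool) :
    Runs O blockBody (st [a0, c :: C, P, a3, Y, [], a6, W, [], [r], a10, a11])
      (1500 * (W.length + Y.length + 1))
      (st [a0, C, P.drop (W.length + Y.length), a3, Y, [], a6, W, [], [r || !exceeds W P], a10,
        a11]) := by
  have h1 : Runs O (.pop 1 ⨾ .push 8 false) (st [a0, c :: C, P, a3, Y, [], a6, W, [], [r], a10, a11])
      2 (st [a0, C, P, a3, Y, [], a6, W, [false], [r], a10, a11]) :=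
    Runs.exec (n := 12) (by decide) rfl (by simp [Prog.exec])
  have h2 := runs_compareBody O W P [] a0 C a3 Y a6 [r] a10 a11 false
  have h3 := runs_move O (a := 5) (b := 7) [a0, C, P.drop W.length, a3, Y, W.reverse ++ [], a6, [],
    [false || exceeds W P], [r], a10, a11] (by simp) (by simp) (by simp)
    (l' := [a0, C, P.drop W.length, a3, Y, [], a6, W, [exceeds W P], [r], a10, a11]) (by simp)
  have h4 := runs_skipBody O Y (P.drop W.length) [] a0 C a3 a6 W [exceeds W P] [r] a10 a11
  have h5 := runs_move O (a := 5) (b := 4) [a0, C, (P.drop W.length).drop Y.length, a3, [],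
    Y.reverse ++ [], a6, W, [exceeds W P], [r], a10, a11] (by simp) (by simp) (by simp)
    (l' := [a0, C, P.drop (W.length + Y.length), a3, Y, [], a6, W, [exceeds W P], [r], a10, a11])
    (by simp)
  have h6 : Runs O (readBit 8 fun h => if h then .skip else setTrue 9)
      (st [a0, C, P.drop (W.length + Y.length), a3, Y, [], a6, W, [exceeds W P], [r], a10, a11]) 20
      (st [a0, C, P.drop (W.length + Y.length), a3, Y, [], a6, W, [], [r || !exceeds W P], a10,
        a11]) :=
    Runs.mono (Runs.exec (n := 12) (by decide) rfl
      (by generalize exceeds W P = h; cases h <;> simp [Prog.exec, setTrue])) (by decide)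
  refine (h1.seq (h2.seq (h3.seq (h4.seq (h5.seq h6))))).mono ?_
  simp
  omega

theorem runs_blockLoop (C P Y W a0 a3 a6 a10 a11 : List Bool) (r : Bool) :
    Runs O (.loop 1 blockBody) (st [a0, C, P, a3, Y, [], a6, W, [], [r], a10, a11])
      (1501 * (W.length + Y.length + 1) * (C.length + 1))
      (st [a0, [], (compareBlocks W Y.length C P r).1, a3, Y, [], a6, W, [],
        [(compareBlocks W Y.length C P r).2], a10, a11]) := by
  induction C generalizing P r with
  | nil => exact Runs.loop_done (by simp) (by simp [compareBlocks]) (by simp; omega)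
  | cons c C ih =>
    refine (Runs.loop_cons (by simp [st]) (runs_blockBody O C P Y W a0 a3 a6 a10 a11 c r)
      ((ih _ _).to (by rw [compareBlocks]))).mono ?_
    simp only [List.length_cons]
    nlinarith

/-! ### Lengths of intermediate words and the running time of the verifier -/

theorem length_decodeBits (Q P : List Bool) :
    (decodeBits Q P).1.length ≤ Q.length ∧ (decodeBits Q P).2.length ≤ Q.length + P.length := by
  induction Q, P using decodeBits.induct <;> simp_all [decodeBits]
  all_goals omega

theorem length_readUnary (Q C X : List Bool) :
    (readUnary Q C X).1.length ≤ Q.length ∧ (readUnary Q C X).2.1.length ≤ C.length ∧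
      (readUnary Q C X).2.2.length ≤ Q.length + X.length := by
  induction Q, C, X using readUnary.induct <;> simp_all [readUnary]
  all_goals omega

theorem length_maskBits (g : Bool) (X Q : List Bool) :
    (maskBits g X Q).length = 2 * X.length := by
  induction X generalizing Q with
  | nil => rfl
  | cons x X ih => simp [maskBits, ih]; omega

theorem length_marker_le (X : List Bool) : (marker X).length ≤ 1 := by
  cases X <;> simp [marker]

theorem length_readClauses (X Y Q C Z : List Bool) (r : Bool) :
    (readClauses X Y Q C Z r).2.1.length ≤ C.length ∧
      (readClauses X Y Q C Z r).2.2.1.length ≤ Z.length + (2 * X.length + 1) * Q.length := by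
  induction Q, C, Z, r using readClauses.induct X Y with
  | case1 => simp [readClauses]
  | case2 => simp [readClauses]
  | case3 Q C Z r ih =>
    rw [readClauses]
    refine ⟨ih.1.trans (by simp), ih.2.trans ?_⟩
    have h1 : (Q.drop (2 * X.length + 2 * Y.length)).length ≤ Q.length := by simp
    have h2 := length_marker_le X
    simp only [List.length_append, List.length_reverse, length_maskBits, List.length_cons]
    nlinarith

/-- The answer of the verifier. -/
def verdict (x w : List Bool) : Bool :=
  let d := decodeBits x []
  let i := readUnary d.1 w []
  let o := readUnary i.1 i.2.1 []
  let c := readClauses i.2.2 o.2.2 o.1 o.2.1 [true] false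
  let W := (false :: c.2.2.1).reverse
  let b := compareBlocks W o.2.2.length c.2.1 d.2 c.2.2.2
  !(b.2 || b.1.isEmpty || mismatch W b.1 || mismatch o.2.2 (b.1.drop W.length) ||
    !(b.1.drop (W.length + o.2.2.length)).isEmpty)

theorem load_eq_st (x w : List Bool) :
    load x w = st [x, w, [], [], [], [], [], [], [], [], [], []] := by
  funext r
  match r with
  | 0 | 1 | 2 | 3 | 4 | 5 | 6 | 7 | 8 | 9 | 10 | 11 => rfl
  | r + 12 => simp [load, st]

/-- The time is cubic because the new block has length at most quadratic in `x.length` and may be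
traversed once for each bit of the certificate. The answer is defined for all words, including
malformed ones. -/
theorem runs_verifier (x w : List Bool) :
    ∃ s, Runs O verifier (load x w) (50000 * (x.length + w.length + 1) ^ 3) s ∧
      (s 0).head? = some (verdict x w) := by
  rw [load_eq_st]
  unfold verdict
  obtain ⟨hd1, hd2⟩ := length_decodeBits x []
  have h1 := runs_decodeBits O x [] w [] [] [] [] [] [] [false] []
  generalize decodeBits x [] = d at *
  obtain ⟨Q, P⟩ := d
  obtain ⟨hi1, hi2, hi3⟩ := length_readUnary Q w []
  have h2 := runs_readUnary_inputs O Q w [] P [] [] [] [] [] [false] []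
  simp only at *
  generalize readUnary Q w [] = i at *
  obtain ⟨Q1, C1, X⟩ := i
  obtain ⟨ho1, ho2, ho3⟩ := length_readUnary Q1 C1 []
  have h3 := runs_readUnary_outputs O Q1 C1 [] P X [] [] [] [] [false] []
  simp only at *
  generalize readUnary Q1 C1 [] = o at *
  obtain ⟨Q2, C2, Y⟩ := o
  obtain ⟨hc1, hc2⟩ := length_readClauses X Y Q2 C2 [true] false
  have h4 := runs_clauseLoop O Q2 C2 X Y [true] P [] false
  simp only at *
  generalize readClauses X Y Q2 C2 [true] false = c at *
  obtain ⟨Q3, C3, Z, r⟩ := c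
  simp only at *
  have h5 := runs_move O (a := 6) (b := 7) [Q3, C3, P, X, Y, [], false :: Z, [], [], [r], [], []]
    (by simp) (by simp) (by simp)
    (l' := [Q3, C3, P, X, Y, [], [], (false :: Z).reverse, [], [r], [], []]) (by simp)
  have hW : (false :: Z).reverse.length = Z.length + 1 := by simp
  generalize (false :: Z).reverse = W at *
  have h6 := runs_blockLoop O C3 P Y W Q3 X [] [] [] r
  generalize compareBlocks W Y.length C3 P r = b at *
  obtain ⟨P', r'⟩ := b
  simp only at *
  have h7 : Runs O (.branch 2 (setTrue 9) .skip .skip)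
      (st [Q3, [], P', X, Y, [], [], W, [], [r'], [], []]) 20
      (st [Q3, [], P', X, Y, [], [], W, [], [r' || P'.isEmpty], [], []]) :=
    Runs.mono (Runs.exec (n := 12) (by decide) rfl
      (by rcases P' with _ | ⟨_ | _, P'⟩ <;> simp [Prog.exec, setTrue])) (by decide)
  have h8 := runs_prefixBody_block O W P' Q3 [] X Y [] [] [] [] [] (r' || P'.isEmpty)
  have h9 := runs_prefixBody_outputs O Y (P'.drop W.length) Q3 [] X [] [] [] [] [] []
    (r' || P'.isEmpty || mismatch W P')
  rw [List.drop_drop] at h9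
  generalize (r' || P'.isEmpty || mismatch W P' || mismatch Y (P'.drop W.length)) = r'' at *
  generalize P'.drop (W.length + Y.length) = P'' at *
  have h10 : Runs O (.branch 2 .skip (setTrue 9) (setTrue 9))
      (st [Q3, [], P'', X, [], [], [], [], [], [r''], [], []]) 20
      (st [Q3, [], P'', X, [], [], [], [], [], [r'' || !P''.isEmpty], [], []]) :=
    Runs.mono (Runs.exec (n := 12) (by decide) rfl
      (by rcases P'' with _ | ⟨_ | _, P''⟩ <;> simp [Prog.exec, setTrue])) (by decide)
  have h11 : Runs O (readBit 9 fun r => .push 0 (!r))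
      (st [Q3, [], P'', X, [], [], [], [], [], [r'' || !P''.isEmpty], [], []]) 20
      (st [(!(r'' || !P''.isEmpty)) :: Q3, [], P'', X, [], [], [], [], [], [], [], []]) :=
    Runs.mono (Runs.exec (n := 12) (by decide) rfl (by simp [Prog.exec])) (by decide)
  have p1 : Runs O (.push 9 false) (st [x, w, [], [], [], [], [], [], [], [], [], []]) 1
      (st [x, w, [], [], [], [], [], [], [], [false], [], []]) :=
    Runs.exec (n := 12) (by decide) rfl (by simp [Prog.exec])
  have p2 : Runs O (.push 6 true) (st [Q2, C2, P, X, Y, [], [], [], [], [false], [], []]) 1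
      (st [Q2, C2, P, X, Y, [], [true], [], [], [false], [], []]) :=
    Runs.exec (n := 12) (by decide) rfl (by simp [Prog.exec])
  have p3 : Runs O (.push 6 false) (st [Q3, C3, P, X, Y, [], Z, [], [], [r], [], []]) 1
      (st [Q3, C3, P, X, Y, [], false :: Z, [], [], [r], [], []]) :=
    Runs.exec (n := 12) (by decide) rfl (by simp [Prog.exec])
  refine ⟨_, (p1.seq (h1.seq (h2.seq (h3.seq (p2.seq (h4.seq (p3.seq (h5.seq (h6.seq (h7.seq
    (h8.seq (h9.seq (h10.seq h11))))))))))))).mono ?_, by simp [st]⟩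
  simp only [List.length_nil, add_zero, List.length_cons, zero_add, List.getD_cons_succ,
    List.getD_cons_zero] at *
  generalize x.length = nx at *
  generalize w.length = nw at *
  generalize P.length = nP at *
  generalize X.length = nX at *
  generalize Y.length = nY at *
  generalize Q.length = nQ at *
  generalize Q1.length = nQ1 at *
  generalize Q2.length = nQ2 at *
  generalize Z.length = nZ at *
  generalize C3.length = nC3 at *
  rw [hW]
  clear h1 h2 h3 h4 h5 h6 h7 h8 h9 h10 h11 p1 p2 p3 hW
  have hX : nX ≤ nx := by omega
  have hY : nY ≤ nx := by omega
  have hQ2 : nQ2 ≤ nx := by omega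
  have hC : nC3 ≤ nw := by omega
  have hZ : nZ ≤ 1 + (2 * nx + 1) * nx := hc2.trans (by gcongr)
  have e1 : 2000 * (nX + nY + 1) * (nQ2 + 1) ≤ 2000 * (nx + nx + 1) * (nx + 1) := by gcongr
  have e2 : 1501 * (nZ + 1 + nY + 1) * (nC3 + 1) ≤
    1501 * (1 + (2 * nx + 1) * nx + 1 + nx + 1) * (nw + 1) := by gcongr
  have e3 : 14 * nQ ≤ 14 * nx := by omega
  have e4 : 14 * nQ1 ≤ 14 * nx := by omega
  have e5 : 2000 * (nx + nx + 1) * (nx + 1) = 4000 * nx ^ 2 + 6000 * nx + 2000 := by ring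
  have e6 : 1501 * (1 + (2 * nx + 1) * nx + 1 + nx + 1) * (nw + 1) = 3002 * (nx ^ 2 * nw) +
    3002 * (nx * nw) + 4503 * nw + 3002 * nx ^ 2 + 3002 * nx + 4503 := by ring
  have e7 : (nx + nw + 1) ^ 3 = nx ^ 3 + nw ^ 3 + 1 + 3 * (nx ^ 2 * nw) + 3 * (nx * nw ^ 2) +
    3 * nx ^ 2 + 3 * nw ^ 2 + 3 * nx + 3 * nw + 6 * (nx * nw) := by ring
  have e8 : (2 * nx + 1) * nx = 2 * nx ^ 2 + nx := by ring
  rw [e8] at hZ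
  rw [e5] at e1
  rw [e6] at e2
  rw [e7]
  linarith [Nat.zero_le (nx ^ 2 * nw), Nat.zero_le (nx ^ 2), Nat.zero_le (nx * nw),
    Nat.zero_le (nx ^ 3), Nat.zero_le (nw ^ 3), Nat.zero_le (nx * nw ^ 2), Nat.zero_le (nw ^ 2)]

/-- The words for which the verifier has a certificate. -/
def extensionLanguage : Language Bool := {x | ∃ w, w.length ≤ x.length ∧ verdict x w = true}

theorem inNP_extensionLanguage : InNP extensionLanguage := by
  refine ⟨verifier, Polynomial.C 50000 * (Polynomial.X + 1) ^ 3, Polynomial.X, verdict, ?_, ?_⟩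
  · intro x w
    obtain ⟨s, ⟨t, ht, hr⟩, hs⟩ := runs_verifier 0 x w
    exact ⟨t, s, hr, by simpa using ht, hs⟩
  · intro x
    simp only [Polynomial.eval_X]
    rfl

/-! ### The synthesizer

The stacks are: 0 the query, 2 the output, 3 a copy of the input (for its length), 4 a temporary
stack, 5 the clock, 6 the next clock, 8 the answer of the oracle, 11 the flag of a loop. -/

/-- The question to the oracle whether the prefix with reversal `r` is extendable. -/
def question (w r : List Bool) : List Bool := (r.flatMap fun b => [true, b]) ++ false :: w

open Classical in
/-- Extend a prefix (in reversed order) bit by bit with the help of the oracle, preferring `true`, and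
stop after appending a `false` if no extension is possible. -/
noncomputable def search (w : List Bool) : ℕ → List Bool → List Bool
  | 0, r => r
  | n + 1, r =>
    if question w (true :: r) ∈ extensionLanguage then search w n (true :: r)
    else if question w (false :: r) ∈ extensionLanguage then search w n (false :: r)
    else false :: r

/-- Empty a stack. -/
def clear (r : ℕ) : Prog := .loop r (.pop r)

/-- Try to extend the prefix on stack `0` by a bit. -/
def searchBody : Prog :=
  (.pop 5 ⨾ .push 0 true ⨾ .push 0 true) ⨾ .query 0 8 ⨾
    readBit 8 fun a => if a then .skip else
      (.pop 0 ⨾ .pop 0 ⨾ .push 0 false ⨾ .push 0 true) ⨾ .query 0 8 ⨾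
        readBit 8 fun a => if a then .skip else clear 5

/-- Put a copy of stack `0` on stack `3`. -/
def copyInput : Prog := .loop 0 (readBit 0 fun b => .push 4 b ⨾ .push 3 b) ⨾ move 4 0

/-- Multiply the length of the clock by that of stack `3`. -/
def multiplyClock : Prog :=
  .loop 5 (.pop 5 ⨾ .loop 3 (readBit 3 fun b => .push 4 b ⨾ .push 6 b) ⨾ move 4 3) ⨾ move 6 5

/-- Put a word of length `n ^ k` on stack `5`, where `n` is the length of stack `3`. -/
def clock : ℕ → Prog
  | 0 => .push 5 true
  | k + 1 => clock k ⨾ multiplyClock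

/-- The synthesizer whose clock is the `k`-th power of the length of the input. -/
def synthesizer (k : ℕ) : Prog :=
  copyInput ⨾ clock k ⨾ .push 0 false ⨾ .loop 5 searchBody ⨾ readLoop 0 2 ⨾ clear 0 ⨾ move 2 4 ⨾
    move 4 0

/-! ### Running time of the synthesizer -/

theorem Runs.query {O : Language Bool} {r a : ℕ} {b : Bool} {l l' : List (List Bool)}
    (ha : a < l.length) (h : b = true ↔ l.getD r [] ∈ O) (hl : l.set a (b :: l.getD a []) = l') :
    Runs O (.query r a) (st l) 1 (st l') := by
  subst hl
  refine ⟨1, le_rfl, ?_⟩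
  rw [← st_set _ ha]
  exact .query _ _ _ _ h

theorem runs_clear_input (v a1 a2 a3 a4 a5 a6 a7 a8 a9 a10 a11 : List Bool) :
    Runs O (clear 0) (st [v, a1, a2, a3, a4, a5, a6, a7, a8, a9, a10, a11]) (2 * v.length + 1)
      (st [[], a1, a2, a3, a4, a5, a6, a7, a8, a9, a10, a11]) := by
  induction v with
  | nil => exact Runs.loop_done rfl rfl (by simp)
  | cons b v ih =>
    exact Runs.loop_step (n := 12) (by decide) rfl (by simp) (by simp [Prog.exec]) ih
      (by simp [Prog.cost]; omega)

theorem runs_clear_clock (v a0 a1 a2 a3 a4 a6 a7 a8 a9 a10 a11 : List Bool) :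
    Runs O (clear 5) (st [a0, a1, a2, a3, a4, v, a6, a7, a8, a9, a10, a11]) (2 * v.length + 1)
      (st [a0, a1, a2, a3, a4, [], a6, a7, a8, a9, a10, a11]) := by
  induction v with
  | nil => exact Runs.loop_done rfl rfl (by simp)
  | cons b v ih =>
    exact Runs.loop_step (n := 12) (by decide) rfl (by simp) (by simp [Prog.exec]) ih
      (by simp [Prog.cost]; omega)

theorem question_cons (w r : List Bool) (b : Bool) :
    question w (b :: r) = true :: b :: question w r := rfl

/-- Each round consumes one bit of the clock. The reversed prefix lies on top of stack `0`, so it is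
extended by pushing two bits. If neither bit is possible, emptying the clock ends the loop and
leaves the final `false` in place. -/
theorem runs_search (w r K a1 a2 a3 a4 a6 a7 a9 a10 a11 : List Bool) :
    Runs extensionLanguage (.loop 5 searchBody)
      (st [question w r, a1, a2, a3, a4, K, a6, a7, [], a9, a10, a11]) (50 * K.length + 2)
      (st [question w (search w K.length r), a1, a2, a3, a4, [], a6, a7, [], a9, a10, a11]) := by
  classical
  induction K generalizing r with
  | nil => exact Runs.loop_done rfl rfl (by simp)
  | cons b K ih =>
    have h1 : Runs extensionLanguage (.pop 5 ⨾ .push 0 true ⨾ .push 0 true)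
      (st [question w r, a1, a2, a3, a4, b :: K, a6, a7, [], a9, a10, a11]) 3
      (st [question w (true :: r), a1, a2, a3, a4, K, a6, a7, [], a9, a10, a11]) :=
      Runs.exec (n := 12) (by decide) rfl (by simp [Prog.exec, question_cons])
    have h2 : Runs extensionLanguage (.query 0 8)
      (st [question w (true :: r), a1, a2, a3, a4, K, a6, a7, [], a9, a10, a11]) 1
      (st [question w (true :: r), a1, a2, a3, a4, K, a6, a7,
        [decide (question w (true :: r) ∈ extensionLanguage)], a9, a10, a11]) :=
      Runs.query (by simp) decide_eq_true_iff rfl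
    have h3 : Runs extensionLanguage (.pop 0 ⨾ .pop 0 ⨾ .push 0 false ⨾ .push 0 true)
      (st [question w (true :: r), a1, a2, a3, a4, K, a6, a7, [], a9, a10, a11]) 4
      (st [question w (false :: r), a1, a2, a3, a4, K, a6, a7, [], a9, a10, a11]) :=
      Runs.exec (n := 12) (by decide) rfl (by simp [Prog.exec, question_cons])
    have h4 : Runs extensionLanguage (.query 0 8)
      (st [question w (false :: r), a1, a2, a3, a4, K, a6, a7, [], a9, a10, a11]) 1
      (st [question w (false :: r), a1, a2, a3, a4, K, a6, a7,
        [decide (question w (false :: r) ∈ extensionLanguage)], a9, a10, a11]) :=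
      Runs.query (by simp) decide_eq_true_iff rfl
    have hskip : ∀ s, Runs extensionLanguage .skip s 1 s := fun s => ⟨1, le_rfl, .skip s⟩
    rw [List.length_cons, search]
    split_ifs with ht hf
    · simp only [ht, decide_true] at h2
      exact (Runs.loop_cons (by simp [st])
        (h1.seq (h2.seq (Runs.readBit (by simp) (hskip _)))) (ih _)).mono (by omega)
    · simp only [ht, decide_false] at h2
      simp only [hf, decide_true] at h4
      exact (Runs.loop_cons (by simp [st]) (h1.seq (h2.seq (Runs.readBit (by simp)
        (h3.seq (h4.seq (Runs.readBit (by simp) (hskip _))))))) (ih _)).mono (by omega)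
    · simp only [ht, decide_false] at h2
      simp only [hf, decide_false] at h4
      exact (Runs.loop_cons (by simp [st]) (h1.seq (h2.seq (Runs.readBit (by simp)
        (h3.seq (h4.seq (Runs.readBit (by simp) (runs_clear_clock ..)))))))
        (Runs.loop_done (B := 1) rfl rfl le_rfl)).mono (by omega)

theorem runs_copyInput (w : List Bool) :
    Runs O copyInput (st [w, [], [], [], [], [], [], [], [], [], [], []]) (50 * w.length + 2)
      (st [w, [], [], w.reverse, [], [], [], [], [], [], [], []]) := by
  have h : ∀ v t, Runs O (.loop 0 (readBit 0 fun b => .push 4 b ⨾ .push 3 b))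
      (st [v, [], [], t, t, [], [], [], [], [], [], []]) (20 * v.length + 1)
      (st [[], [], [], v.reverse ++ t, v.reverse ++ t, [], [], [], [], [], [], []]) := by
    intro v
    induction v with
    | nil => exact fun t => Runs.loop_done rfl rfl (by simp)
    | cons b v ih =>
      intro t
      exact Runs.loop_step (n := 12) (by decide) rfl (by simp) (by simp [Prog.exec])
        ((ih (b :: t)).to (by simp)) (by simp [Prog.cost, readBit]; omega)
  refine ((h w []).seq (runs_move O _ (by simp) (by simp) (by simp) (by simp))).mono ?_
  simp
  omega

/-- Only the length of the clock matters, so its bits are left unspecified. -/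
theorem exists_runs_multiplyClock (w N K : List Bool) :
    ∃ K' : List Bool, K'.length = K.length * N.length ∧
      Runs O multiplyClock (st [w, [], [], N, [], K, [], [], [], [], [], []])
        (60 * (N.length + 1) * (K.length + 1))
        (st [w, [], [], N, [], K', [], [], [], [], [], []]) := by
  have h1 : ∀ v t K J, Runs O (.loop 3 (readBit 3 fun b => .push 4 b ⨾ .push 6 b))
      (st [w, [], [], v, t, K, J, [], [], [], [], []]) (20 * v.length + 1)
      (st [w, [], [], [], v.reverse ++ t, K, v.reverse ++ J, [], [], [], [], []]) := by
    intro v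
    induction v with
    | nil => exact fun t K J => Runs.loop_done rfl rfl (by simp)
    | cons b v ih =>
      intro t K J
      exact Runs.loop_step (n := 12) (by decide) rfl (by simp) (by simp [Prog.exec])
        ((ih (b :: t) K (b :: J)).to (by simp)) (by simp [Prog.cost, readBit]; omega)
  have h2 : ∀ K J : List Bool, ∃ J' : List Bool, J'.length = K.length * N.length + J.length ∧
      Runs O (.loop 5 (.pop 5 ⨾ .loop 3 (readBit 3 fun b => .push 4 b ⨾ .push 6 b) ⨾ move 4 3))
        (st [w, [], [], N, [], K, J, [], [], [], [], []]) (40 * (N.length + 1) * K.length + 1)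
        (st [w, [], [], N, [], [], J', [], [], [], [], []]) := by
    intro K
    induction K with
    | nil => exact fun J => ⟨J, by simp, Runs.loop_done rfl rfl (by simp)⟩
    | cons b K ih =>
      intro J
      obtain ⟨J', hJ', hr⟩ := ih (N.reverse ++ J)
      refine ⟨J', by rw [hJ']; simp; ring, (Runs.loop_cons (by simp [st])
        ((Runs.exec (n := 12) (P := .pop 5) (by decide) rfl rfl).seq ((h1 N [] K J).seq
        (runs_move O _ (by simp) (by simp) (by simp) (by simp)))) hr).mono ?_⟩
      simp [Prog.cost]
      nlinarith
  obtain ⟨J', hJ', hr⟩ := h2 K []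
  refine ⟨J'.reverse, by simp [hJ'], (hr.seq
    (runs_move O _ (by simp) (by simp) (by simp) (by simp))).mono ?_⟩
  simp only [List.length_nil, add_zero] at hJ'
  simp [hJ']
  nlinarith

theorem exists_runs_clock (w N : List Bool) (k : ℕ) :
    ∃ K : List Bool, K.length = N.length ^ k ∧
      Runs O (clock k) (st [w, [], [], N, [], [], [], [], [], [], [], []])
        (120 * (k + 1) * (N.length + 1) ^ (k + 1))
        (st [w, [], [], N, [], K, [], [], [], [], [], []]) := by
  induction k with
  | zero =>
    exact ⟨[true], by simp, (Runs.exec (n := 12) (P := .push 5 true) (by decide) rfl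
      (by simp [Prog.exec])).mono (by simp [Prog.cost]; omega)⟩
  | succ k ih =>
    obtain ⟨K, hK, hr⟩ := ih
    obtain ⟨K', hK', hr'⟩ := exists_runs_multiplyClock O w N K
    refine ⟨K', by rw [hK', hK, pow_succ], (hr.seq hr').mono ?_⟩
    have h1 : N.length ^ k ≤ (N.length + 1) ^ k := by gcongr; omega
    have h2 : 1 ≤ (N.length + 1) ^ k := Nat.one_le_pow _ _ (by omega)
    have h3 : N.length ^ k + 1 ≤ 2 * (N.length + 1) ^ k := by omega
    have h4 : (N.length + 1) ^ (k + 1) ≤ (N.length + 1) ^ (k + 1 + 1) :=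
      Nat.pow_le_pow_right (by omega) (by omega)
    have h5 : 60 * (N.length + 1) * (N.length ^ k + 1) ≤
        60 * (N.length + 1) * (2 * (N.length + 1) ^ k) := by gcongr
    have h6 : 60 * (N.length + 1) * (2 * (N.length + 1) ^ k) = 120 * (N.length + 1) ^ (k + 1) := by
      ring
    have h7 : 120 * (k + 1) * (N.length + 1) ^ (k + 1) ≤
      120 * (k + 1) * (N.length + 1) ^ (k + 1 + 1) := by gcongr
    rw [hK]
    nlinarith

theorem decodeBits_question (w r P : List Bool) :
    decodeBits (question w r) P = (w, r.reverse ++ P) := by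
  induction r generalizing P with
  | nil => simp [question, decodeBits]
  | cons b r ih => rw [question_cons, decodeBits, ih]; simp

theorem length_question (w r : List Bool) :
    (question w r).length = 2 * r.length + w.length + 1 := by
  induction r with
  | nil => simp [question]
  | cons b r ih => rw [question_cons]; simp [ih]; omega

theorem length_search_le (w : List Bool) (n : ℕ) (r : List Bool) :
    (search w n r).length ≤ r.length + n := by
  induction n generalizing r with
  | zero => simp [search]
  | succ n ih =>
    rw [search]
    split_ifs
    · exact (ih _).trans (by simp; omega)
    · exact (ih _).trans (by simp; omega)
    · simp

/-- The function computed by the synthesizer. -/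
noncomputable def synthesize (k : ℕ) (w : List Bool) : List Bool :=
  (search w (w.length ^ k) []).reverse

theorem inFPNP_synthesize (k : ℕ) : InFPNP (synthesize k) := by
  refine ⟨extensionLanguage, inNP_extensionLanguage, synthesizer k,
    Polynomial.C (120 * (k + 1)) * (Polynomial.X + 1) ^ (k + 1) +
      Polynomial.C 200 * (Polynomial.X ^ k + Polynomial.X + 1), fun w => ?_⟩
  obtain ⟨K, hK, hclock⟩ := exists_runs_clock extensionLanguage w w.reverse k
  rw [List.length_reverse] at hK
  have h1 := runs_copyInput extensionLanguage w
  have h2 : Runs extensionLanguage (.push 0 false)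
      (st [w, [], [], w.reverse, [], K, [], [], [], [], [], []]) 1
      (st [question w [], [], [], w.reverse, [], K, [], [], [], [], [], []]) :=
    Runs.exec (n := 12) (by decide) rfl (by simp [Prog.exec, question])
  have h3 := runs_search w [] K [] [] w.reverse [] [] [] [] [] []
  have hlen := length_search_le w K.length []
  have hout : synthesize k w = (search w K.length []).reverse := by rw [hK]; rfl
  generalize search w K.length [] = r at *
  have h4 := runs_decodeBits extensionLanguage (question w r) [] [] w.reverse [] [] [] [] [] [] []
  rw [decodeBits_question, length_question, List.append_nil] at h4
  have h5 := runs_clear_input extensionLanguage w [] r.reverse w.reverse [] [] [] [] [] [] [] []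
  -- Each move reverses the word, so two moves bring the output to stack `0` in its original order.
  have h6 := runs_move extensionLanguage (a := 2) (b := 4)
    [[], [], r.reverse, w.reverse, [], [], [], [], [], [], [], []] (by simp) (by simp) (by simp)
    (l' := [[], [], [], w.reverse, r, [], [], [], [], [], [], []]) (by simp)
  have h7 := runs_move extensionLanguage (a := 4) (b := 0)
    [[], [], [], w.reverse, r, [], [], [], [], [], [], []] (by simp) (by simp) (by simp)
    (l' := [r.reverse, [], [], w.reverse, [], [], [], [], [], [], [], []]) (by simp)
  obtain ⟨t, ht, hr⟩ := h1.seq (hclock.seq (h2.seq (h3.seq (h4.seq (h5.seq (h6.seq h7))))))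
  refine ⟨t, _, load_eq_st w [] ▸ hr, ht.trans ?_, hout ▸ rfl⟩
  simp at hlen
  simp [hK] at hlen ⊢
  omega

end Programs

/-! ### The language of the verifier -/

/-- The values of an assignment in order. -/
def assignmentBits {m : ℕ} (x : Fin m → Bool) : List Bool := (List.finRange m).map x

@[simp] theorem length_assignmentBits {m : ℕ} (x : Fin m → Bool) :
    (assignmentBits x).length = m := by simp [assignmentBits]

theorem exists_assignmentBits_eq {m : ℕ} {X : List Bool} (h : X.length = m) :
    ∃ x : Fin m → Bool, assignmentBits x = X := by
  subst h
  exact ⟨fun i => X[i], by simp [assignmentBits]⟩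

@[simp] theorem length_clauseBits {m : ℕ} (C : Clause (Fin m)) :
    (clauseBits C).length = 2 * m := by
  simp [clauseBits, List.length_flatMap, mul_comm]

theorem eval_eq_true_iff {V : Type} [DecidableEq V] (C : Clause V) (a : V → Bool) :
    C.eval a = true ↔ ∃ v, (v, a v) ∈ C := by
  simp only [Clause.eval, decide_eq_true_eq]
  constructor
  · rintro ⟨⟨v, b⟩, h, hb⟩
    exact ⟨v, by simp only at hb; rw [hb]; exact h⟩
  · rintro ⟨v, h⟩; exact ⟨_, h, rfl⟩

theorem eval_sumElim {m n : ℕ} (C : Clause (Fin m ⊕ Fin n)) (x : Fin m → Bool) (y : Fin n → Bool) :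
    C.eval (Sum.elim x y) = ((inPart C).eval x || (outPart C).eval y) := by
  rw [Bool.eq_iff_iff, Bool.or_eq_true, eval_eq_true_iff, eval_eq_true_iff, eval_eq_true_iff]
  simp [inPart, outPart]

theorem hit_clauseBits {m : ℕ} (C : Clause (Fin m)) (x : Fin m → Bool) (Q : List Bool) :
    hit (assignmentBits x) (clauseBits C ++ Q) = C.eval x := by
  have h : ∀ l : List (Fin m), hit (l.map x)
      ((l.flatMap fun i => [decide ((i, true) ∈ C), decide ((i, false) ∈ C)]) ++ Q) =
      l.any fun i => decide ((i, x i) ∈ C) := by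
    intro l
    induction l with
    | nil => rfl
    | cons i l ih =>
      simp only [List.map_cons, List.flatMap_cons, hit, List.cons_append,
        List.nil_append, List.tail_cons, List.headD_cons, ih, List.any_cons]
      cases x i <;> rfl
  rw [assignmentBits, clauseBits, h, Bool.eq_iff_iff, eval_eq_true_iff]
  simp

theorem maskBits_clauseBits {m : ℕ} (C : Clause (Fin m)) (x : Fin m → Bool) (Q : List Bool)
    (g : Bool) : maskBits g (assignmentBits x) (clauseBits C ++ Q) =
      clauseBits (if g then Finset.univ else C) := by
  have h : ∀ l : List (Fin m), maskBits g (l.map x)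
      ((l.flatMap fun i => [decide ((i, true) ∈ C), decide ((i, false) ∈ C)]) ++ Q) =
      l.flatMap fun i => [decide ((i, true) ∈ if g then Finset.univ else C),
        decide ((i, false) ∈ if g then Finset.univ else C)] := by
    intro l
    induction l with
    | nil => rfl
    | cons i l ih =>
      simp only [List.map_cons, List.flatMap_cons, maskBits, List.cons_append,
        List.nil_append, List.tail_cons, List.headD_cons, ih]
      cases g <;> simp
  exact h _

/-- The input part of a clause if the assignment satisfies it, and the full clause otherwise. -/
def testClause {m n : ℕ} (x : Fin m → Bool) (C : Clause (Fin m ⊕ Fin n)) : Clause (Fin m) :=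
  if (inPart C).eval x then inPart C else Finset.univ

/-- The part of a block with the test of an entry of a decision list. -/
def clausesBits {m n : ℕ} (x : Fin m → Bool) (cl : List (Clause (Fin m ⊕ Fin n))) : List Bool :=
  cl.flatMap fun C => marker (assignmentBits x) ++ clauseBits (testClause x C)

/-- The encoding of the test of an entry of a decision list, with its markers. -/
def testBits (F : Spec) (x : Fin F.numIn → Bool) : List Bool :=
  true :: (clausesBits x F.clauses ++ [false])

/-- The encoding of an entry of a decision list. -/
def block (F : Spec) (x : Fin F.numIn → Bool) (y : Fin F.numOut → Bool) : List Bool :=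
  testBits F x ++ assignmentBits y

/-- The clauses of a specification as a bit string. -/
def bodyBits {m n : ℕ} (cl : List (Clause (Fin m ⊕ Fin n))) : List Bool :=
  (cl.flatMap fun C => true :: (clauseBits (inPart C) ++ clauseBits (outPart C))) ++ [false]

theorem encode_eq (F : Spec) : F.encode = List.replicate F.numIn true ++ false ::
    (List.replicate F.numOut true ++ false :: bodyBits F.clauses) := by
  simp [Spec.encode, bodyBits]

/-- The mask bit must be the negation of the truth value of the input part. A masked clause then
needs a true output literal, while an unmasked one is already satisfied. -/
theorem badClause_clauseBits {m n : ℕ} (x : Fin m → Bool) (y : Fin n → Bool)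
    (C : Clause (Fin m ⊕ Fin n)) (Q : List Bool) (g : Bool) :
    badClause (assignmentBits x) (assignmentBits y)
      (clauseBits (inPart C) ++ (clauseBits (outPart C) ++ Q)) g = false ↔
      g = !(inPart C).eval x ∧ C.eval (Sum.elim x y) = true := by
  have h : (clauseBits (inPart C) ++ (clauseBits (outPart C) ++ Q)).drop
      (2 * (assignmentBits x).length) = clauseBits (outPart C) ++ Q := by
    rw [length_assignmentBits, ← length_clauseBits (inPart C), List.drop_left]
  rw [badClause, h, hit_clauseBits, hit_clauseBits, eval_sumElim]
  cases g <;> cases (inPart C).eval x <;> cases (outPart C).eval y <;> simp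

theorem readClauses_cons {m n : ℕ} (x : Fin m → Bool) (y : Fin n → Bool)
    (C : Clause (Fin m ⊕ Fin n)) (cl : List (Clause (Fin m ⊕ Fin n))) (w Z : List Bool) (r : Bool) :
    readClauses (assignmentBits x) (assignmentBits y) (bodyBits (C :: cl)) w Z r =
      readClauses (assignmentBits x) (assignmentBits y) (bodyBits cl) w.tail
        ((clauseBits (if w.headD false then Finset.univ else inPart C)).reverse ++
          (marker (assignmentBits x) ++ Z))
        (r || badClause (assignmentBits x) (assignmentBits y)
          (clauseBits (inPart C) ++ (clauseBits (outPart C) ++ bodyBits cl)) (w.headD false)) := by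
  have h : (clauseBits (inPart C) ++ (clauseBits (outPart C) ++ bodyBits cl)).drop
      (2 * (assignmentBits x).length + 2 * (assignmentBits y).length) = bodyBits cl := by
    rw [length_assignmentBits, length_assignmentBits, ← length_clauseBits (inPart C),
      ← length_clauseBits (outPart C), ← List.length_append, ← List.append_assoc, List.drop_left]
  have hb : bodyBits (C :: cl) =
      true :: (clauseBits (inPart C) ++ (clauseBits (outPart C) ++ bodyBits cl)) := by
    simp [bodyBits]
  rw [hb, readClauses, h, maskBits_clauseBits]

theorem reverse_marker (X : List Bool) : (marker X).reverse = marker X := by cases X <;> rfl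

theorem readClauses_accepts {m n : ℕ} (x : Fin m → Bool) (y : Fin n → Bool)
    (cl : List (Clause (Fin m ⊕ Fin n))) (w Z : List Bool)
    (h : ∀ C ∈ cl, C.eval (Sum.elim x y) = true) :
    readClauses (assignmentBits x) (assignmentBits y) (bodyBits cl)
      ((cl.map fun C => !(inPart C).eval x) ++ w) Z false =
      ([], w, (clausesBits x cl).reverse ++ Z, false) := by
  induction cl generalizing Z with
  | nil => simp [bodyBits, readClauses, clausesBits]
  | cons C cl ih =>
    have hbad := (badClause_clauseBits x y C (bodyBits cl) _).2 ⟨rfl, h C (by simp)⟩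
    rw [readClauses_cons]
    simp only [List.map_cons, List.cons_append, List.headD_cons, List.tail_cons, hbad,
      Bool.or_false]
    rw [ih _ fun C hC => h C (List.mem_cons_of_mem _ hC)]
    have : (if (!(inPart C).eval x) = true then Finset.univ else inPart C) = testClause x C := by
      unfold testClause
      cases (inPart C).eval x <;> rfl
    rw [this]
    simp [clausesBits, reverse_marker]

/-- The rejection flag is never lowered. -/
theorem readClauses_rejects {X Y Q w Z : List Bool} :
    (readClauses X Y Q w Z true).2.2.2 = true := by
  generalize hr : true = r
  induction Q, w, Z, r using readClauses.induct X Y with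
  | case1 => simp [readClauses, ← hr]
  | case2 => simp [readClauses, ← hr]
  | case3 Q C Z r ih => subst hr; rw [readClauses]; exact (ih (by simp)).trans (by simp)

/-- Acceptance forces every mask bit to be correct, so the block built from an arbitrary accepted
certificate is the test of `x`. -/
theorem readClauses_sound {m n : ℕ} (x : Fin m → Bool) (y : Fin n → Bool)
    (cl : List (Clause (Fin m ⊕ Fin n))) (w Z : List Bool)
    (h : (readClauses (assignmentBits x) (assignmentBits y) (bodyBits cl) w Z false).2.2.2 = false) :
    (∀ C ∈ cl, C.eval (Sum.elim x y) = true) ∧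
      (readClauses (assignmentBits x) (assignmentBits y) (bodyBits cl) w Z false).2.2.1 =
        (clausesBits x cl).reverse ++ Z := by
  induction cl generalizing w Z with
  | nil => simp [bodyBits, readClauses, clausesBits]
  | cons C cl ih =>
    rw [readClauses_cons, Bool.false_or] at h ⊢
    rcases hbad : badClause (assignmentBits x) (assignmentBits y)
      (clauseBits (inPart C) ++ (clauseBits (outPart C) ++ bodyBits cl)) (w.headD false) with _ | _
    · rw [hbad] at h
      obtain ⟨hg, hC⟩ := (badClause_clauseBits x y C (bodyBits cl) _).1 hbad
      obtain ⟨h1, h2⟩ := ih _ _ h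
      refine ⟨by simpa [hC] using h1, h2.trans ?_⟩
      have : (if w.headD false = true then Finset.univ else inPart C) = testClause x C := by
        rw [hg]
        unfold testClause
        cases (inPart C).eval x <;> rfl
      rw [this]
      simp [clausesBits, reverse_marker]
    · rw [hbad, readClauses_rejects] at h
      cases h

theorem compareBlocks_fst (W : List Bool) (n : ℕ) (C P : List Bool) (r : Bool) :
    (compareBlocks W n C P r).1 = P.drop (C.length * (W.length + n)) := by
  induction C generalizing P r with
  | nil => simp [compareBlocks]
  | cons c C ih => rw [compareBlocks, ih, List.drop_drop]; congr 1; simp; ring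

theorem compareBlocks_snd (W : List Bool) (n : ℕ) (C P : List Bool) (r : Bool) :
    (compareBlocks W n C P r).2 = false ↔
      r = false ∧ ∀ i < C.length, exceeds W (P.drop (i * (W.length + n))) = true := by
  induction C generalizing P r with
  | nil => simp [compareBlocks]
  | cons c C ih =>
    rw [compareBlocks, ih, Bool.or_eq_false_iff, Bool.not_eq_false', and_assoc]
    refine and_congr_right fun _ => ⟨fun ⟨h0, h⟩ i hi => ?_, fun h => ⟨?_, fun i hi => ?_⟩⟩
    · cases i with
      | zero => simpa using h0
      | succ i =>
        have := h i (by simpa using hi)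
        rw [List.drop_drop] at this
        rw [← this]; congr 2; ring
    · simpa using h 0 (by simp)
    · rw [List.drop_drop, ← h (i + 1) (by simpa using hi)]; congr 2; ring

theorem mismatch_append (W Y P : List Bool) :
    mismatch (W ++ Y) P = (mismatch W P || mismatch Y (P.drop W.length)) := by
  induction W generalizing P with
  | nil => simp [mismatch]
  | cons b W ih =>
    cases P with
    | nil => cases Y <;> simp [mismatch]
    | cons p P => simp [mismatch, ih, Bool.or_assoc]

theorem isPrefix_iff_mismatch (V P : List Bool) :
    P <+: V ↔ mismatch V P = false ∧ P.drop V.length = [] := by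
  induction V generalizing P with
  | nil => simp [mismatch]
  | cons b V ih =>
    cases P with
    | nil => simp [mismatch]
    | cons p P =>
      rw [List.cons_prefix_cons, ih]
      simp only [mismatch, Bool.or_eq_false_iff, List.length_cons, List.drop_succ_cons, and_assoc,
        bne_eq_false_iff_eq]
      rw [eq_comm]

theorem length_readUnary_replicate (m : ℕ) (Q C X : List Bool) :
    (readUnary (List.replicate m true ++ false :: Q) C X).1 = Q ∧
    (readUnary (List.replicate m true ++ false :: Q) C X).2.2.length = m + X.length := by
  induction m generalizing C X with
  | zero => simp [readUnary]
  | succ m ih =>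
    rw [List.replicate_succ, List.cons_append, readUnary]
    refine ⟨(ih _ _).1, (ih _ _).2.trans ?_⟩
    simp; omega

theorem readUnary_replicate (V Q C X : List Bool) :
    readUnary (List.replicate V.length true ++ false :: Q) (V ++ C) X = (Q, C, V.reverse ++ X) := by
  induction V generalizing X with
  | nil => simp [readUnary]
  | cons v V ih =>
    simp only [List.length_cons, List.replicate_succ, List.cons_append, readUnary, List.tail_cons,
      List.headD_cons, ih]
    simp

/-- The length of the blocks of a specification. -/
def blockLength (F : Spec) : ℕ :=
  F.clauses.length * ((marker (List.replicate F.numIn true)).length + 2 * F.numIn) + 2 + F.numOut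

theorem marker_eq_of_length_eq {X Y : List Bool} (h : X.length = Y.length) :
    marker X = marker Y := by
  cases X <;> cases Y <;> simp_all [marker]

theorem length_clausesBits {m n : ℕ} (x : Fin m → Bool) (cl : List (Clause (Fin m ⊕ Fin n))) :
    (clausesBits x cl).length =
      cl.length * ((marker (List.replicate m true)).length + 2 * m) := by
  rw [marker_eq_of_length_eq (Y := assignmentBits x) (by simp)]
  induction cl with
  | nil => simp [clausesBits]
  | cons C cl ih =>
    rw [clausesBits] at *
    simp only [List.flatMap_cons, List.length_append, ih, length_clauseBits, List.length_cons]
    ring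

theorem length_testBits (F : Spec) (x : Fin F.numIn → Bool) :
    (testBits F x).length + F.numOut = blockLength F := by
  simp [testBits, length_clausesBits, blockLength]

theorem length_block (F : Spec) (x : Fin F.numIn → Bool) (y : Fin F.numOut → Bool) :
    (block F x y).length = blockLength F := by
  rw [block, List.length_append, length_assignmentBits, length_testBits]

theorem blockLength_pos (F : Spec) : 0 < blockLength F := by rw [blockLength]; omega

theorem length_bodyBits_ge {m n : ℕ} (cl : List (Clause (Fin m ⊕ Fin n))) :
    cl.length * (1 + 2 * m) + 1 ≤ (bodyBits cl).length := by
  induction cl with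
  | nil => simp [bodyBits]
  | cons C cl ih =>
    simp only [bodyBits, List.flatMap_cons, List.length_append, List.length_cons,
      length_clauseBits] at *
    nlinarith

/-- The constant 3 counts the two separators and the final `false`; the bits of the output parts of
the clauses are neglected. -/
theorem length_encode_ge (F : Spec) :
    F.numIn + F.numOut + F.clauses.length * (1 + 2 * F.numIn) + 3 ≤ F.encode.length := by
  have := length_bodyBits_ge F.clauses
  rw [encode_eq]
  simp
  omega

theorem blockLength_le (F : Spec) : blockLength F ≤ F.encode.length := by
  have h1 := length_encode_ge F
  have h2 := length_marker_le (List.replicate F.numIn true)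
  rw [blockLength]
  have : F.clauses.length * ((marker (List.replicate F.numIn true)).length + 2 * F.numIn) ≤
    F.clauses.length * (1 + 2 * F.numIn) := by gcongr
  omega

/-- The oracle accepts a prefix if and only if it consists of some blocks and a nonempty prefix of a
block that satisfies the specification and is somewhere greater than each of the earlier blocks. -/
theorem question_mem_iff (F : Spec) (P : List Bool) :
    question F.encode P.reverse ∈ extensionLanguage ↔ ∃ x y k, F.Holds x y ∧
      (∀ i < k, exceeds (testBits F x) (P.drop (i * blockLength F)) = true) ∧
      P.drop (k * blockLength F) ≠ [] ∧ P.drop (k * blockLength F) <+: block F x y := by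
  constructor
  · rintro ⟨w, -, hw⟩
    unfold verdict at hw
    rw [decodeBits_question, encode_eq] at hw
    simp only at hw
    obtain ⟨hi1, hi2⟩ := length_readUnary_replicate F.numIn
      (List.replicate F.numOut true ++ false :: bodyBits F.clauses) w []
    generalize readUnary (List.replicate F.numIn true ++ false ::
      (List.replicate F.numOut true ++ false :: bodyBits F.clauses)) w [] = i at *
    obtain ⟨Q1, C1, X⟩ := i
    simp only at hi1 hi2 hw
    subst hi1
    obtain ⟨ho1, ho2⟩ := length_readUnary_replicate F.numOut (bodyBits F.clauses) C1 []
    generalize readUnary (List.replicate F.numOut true ++ false :: bodyBits F.clauses) C1 [] = o at *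
    obtain ⟨Q2, C2, Y⟩ := o
    simp only at ho1 ho2 hw
    subst ho1
    obtain ⟨x, rfl⟩ := exists_assignmentBits_eq (show X.length = F.numIn by simpa using hi2)
    obtain ⟨y, rfl⟩ := exists_assignmentBits_eq (show Y.length = F.numOut by simpa using ho2)
    have hsound := readClauses_sound x y F.clauses C2 [true]
    generalize readClauses (assignmentBits x) (assignmentBits y) (bodyBits F.clauses) C2 [true] false
      = c at *
    obtain ⟨Q3, C3, Z, r⟩ := c
    simp only at hw hsound
    simp only [List.reverse_reverse, List.append_nil, compareBlocks_fst, Bool.not_eq_true',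
      Bool.or_eq_false_iff, compareBlocks_snd, Bool.not_eq_false', List.isEmpty_iff,
      List.isEmpty_eq_false_iff] at hw
    obtain ⟨⟨⟨⟨⟨hr, hcmp⟩, hne⟩, hm1⟩, hm2⟩, hend⟩ := hw
    obtain ⟨hholds, rfl⟩ := hsound hr
    have hW : (false :: ((clausesBits x F.clauses).reverse ++ [true])).reverse = testBits F x := by
      simp [testBits]
    simp only [hW, length_assignmentBits, length_testBits] at hcmp hm1 hm2 hne hend
    refine ⟨x, y, C3.length, hholds, hcmp, hne, ?_⟩
    rw [isPrefix_iff_mismatch, block, mismatch_append, hm1, hm2]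
    simpa [length_testBits] using hend
  · rintro ⟨x, y, k, hholds, hcmp, hne, hpre⟩
    -- The certificate consists of the two assignments, reversed because reading onto a stack
    -- reverses them again, the correct mask bits, and `k` in unary.
    refine ⟨(assignmentBits x).reverse ++ ((assignmentBits y).reverse ++
      ((F.clauses.map fun C => !(inPart C).eval x) ++ List.replicate k true)), ?_, ?_⟩
    · have hk : k ≤ P.length := by
        have h1 : k * blockLength F < P.length := by
          by_contra! h
          exact hne (List.drop_eq_nil_of_le h)
        have h2 : k * 1 ≤ k * blockLength F := Nat.mul_le_mul_left _ (blockLength_pos F)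
        omega
      have h3 := length_encode_ge F
      have h4 : F.clauses.length * 1 ≤ F.clauses.length * (1 + 2 * F.numIn) :=
        Nat.mul_le_mul_left _ (by omega)
      simp [length_question]
      omega
    · unfold verdict
      have e1 := readUnary_replicate (assignmentBits x).reverse
        (List.replicate F.numOut true ++ false :: bodyBits F.clauses)
        ((assignmentBits y).reverse ++
          ((F.clauses.map fun C => !(inPart C).eval x) ++ List.replicate k true)) []
      have e2 := readUnary_replicate (assignmentBits y).reverse (bodyBits F.clauses)
        ((F.clauses.map fun C => !(inPart C).eval x) ++ List.replicate k true) []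
      simp only [List.length_reverse, length_assignmentBits, List.reverse_reverse,
        List.append_nil] at e1 e2
      have hW : (false :: ((clausesBits x F.clauses).reverse ++ [true])).reverse = testBits F x := by
        simp [testBits]
      rw [decodeBits_question, encode_eq]
      simp only [e1, e2, readClauses_accepts x y F.clauses (List.replicate k true) [true] hholds]
      rw [hW]
      rw [isPrefix_iff_mismatch, block, mismatch_append, Bool.or_eq_false_iff, List.length_append,
        length_assignmentBits, length_testBits] at hpre
      simp only [List.reverse_reverse, List.append_nil, compareBlocks_fst, Bool.not_eq_true',
        Bool.or_eq_false_iff, compareBlocks_snd, Bool.not_eq_false', List.isEmpty_iff,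
        List.isEmpty_eq_false_iff, length_assignmentBits, length_testBits, List.length_replicate]
      exact ⟨⟨⟨⟨⟨trivial, hcmp⟩, hne⟩, hpre.1.1⟩, hpre.1.2⟩, hpre.2⟩

/-! ### The blocks found by the search -/

theorem exceeds_append {A A' : List Bool} (h : A.length = A'.length) (B B' : List Bool) :
    exceeds (A ++ B) (A' ++ B') = (exceeds A A' || exceeds B B') := by
  induction A generalizing A' with
  | nil => cases A' <;> simp_all [exceeds]
  | cons a A ih =>
    cases A' with
    | nil => simp at h
    | cons a' A' => simp [exceeds, ih (by simpa using h), Bool.or_assoc]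

theorem exceeds_append_right {A A' : List Bool} (h : A.length = A'.length) (B' : List Bool) :
    exceeds A (A' ++ B') = exceeds A A' := by
  simpa [exceeds] using exceeds_append h [] B'

theorem exceeds_self (A : List Bool) : exceeds A A = false := by
  induction A with
  | nil => rfl
  | cons a A ih => simp [exceeds, ih]

theorem exceeds_clauseBits {m : ℕ} (C D : Clause (Fin m)) :
    exceeds (clauseBits C) (clauseBits D) = true ↔ ∃ l ∈ C, l ∉ D := by
  have h : ∀ l : List (Fin m),
      exceeds (l.flatMap fun i => [decide ((i, true) ∈ C), decide ((i, false) ∈ C)])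
        (l.flatMap fun i => [decide ((i, true) ∈ D), decide ((i, false) ∈ D)]) = true ↔
      ∃ i ∈ l, ∃ b, (i, b) ∈ C ∧ (i, b) ∉ D := by
    intro l
    induction l with
    | nil => simp [exceeds]
    | cons i l ih =>
      rw [List.flatMap_cons, List.flatMap_cons, exceeds_append (by simp),
        Bool.or_eq_true, ih]
      simp [exceeds]
      grind
  rw [clauseBits, clauseBits, h]
  constructor
  · rintro ⟨i, -, b, hb⟩; exact ⟨(i, b), hb⟩
  · rintro ⟨⟨i, b⟩, hb⟩; exact ⟨i, List.mem_finRange i, b, hb⟩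

/-- The bits can only grow where `x` has the full clause and `x'` the input part itself. That input
part is not full, since it lacks the literals that are true under `x`; a variable for such a literal
exists because `x'` satisfies the clause. -/
theorem exceeds_testClause {m n : ℕ} (x x' : Fin m → Bool) (C : Clause (Fin m ⊕ Fin n)) :
    exceeds (clauseBits (testClause x C)) (clauseBits (testClause x' C)) = true ↔
      (inPart C).eval x = false ∧ (inPart C).eval x' = true := by
  rw [exceeds_clauseBits]
  unfold testClause
  rcases hx : (inPart C).eval x with _ | _ <;> rcases hx' : (inPart C).eval x' with _ | _ <;> simp
  obtain ⟨v, hv⟩ := (eval_eq_true_iff _ _).1 hx'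
  have hn : (v, x v) ∉ inPart C := fun h => by
    rw [(eval_eq_true_iff _ _).2 ⟨v, h⟩] at hx
    cases hx
  refine ⟨v, ?_⟩
  rcases hb : x v with _ | _ <;> rw [hb] at hn
  · exact Or.inl hn
  · exact Or.inr hn

/-- The pointwise order of the bits of two tests reflects the inclusion of the sets of falsified input
clauses. -/
theorem exceeds_testBits (F : Spec) (x x' : Fin F.numIn → Bool) :
    exceeds (testBits F x) (testBits F x') = true ↔
      ∃ C ∈ F.clauses, (inPart C).eval x = false ∧ (inPart C).eval x' = true := by
  have h : ∀ cl : List (Clause (Fin F.numIn ⊕ Fin F.numOut)),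
      exceeds (clausesBits x cl) (clausesBits x' cl) = true ↔
      ∃ C ∈ cl, (inPart C).eval x = false ∧ (inPart C).eval x' = true := by
    intro cl
    induction cl with
    | nil => simp [clausesBits, exceeds]
    | cons C cl ih =>
      have hm : marker (assignmentBits x) = marker (assignmentBits x') :=
        marker_eq_of_length_eq (by simp)
      rw [clausesBits, clausesBits, List.flatMap_cons, List.flatMap_cons,
        exceeds_append (by simp [hm]), exceeds_append (by simp [hm]), hm, exceeds_self,
        Bool.false_or, Bool.or_eq_true, exceeds_testClause]
      rw [clausesBits, clausesBits, hm] at ih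
      rw [ih]
      simp
  rw [testBits, testBits, exceeds, List.tail_cons, exceeds_append (by simp [length_clausesBits])]
  simp [exceeds, h]

/-- If one list is strictly below another one of the same length in the pointwise order, then there
is a first position where they differ, with `false` in the smaller one. -/
theorem exists_first_difference {A A' : List Bool} (hlen : A.length = A'.length)
    (h : exceeds A A' = false) (h' : exceeds A' A = true) :
    ∃ q, q ++ [false] <+: A ∧ q ++ [true] <+: A' := by
  induction A generalizing A' with
  | nil => cases A' <;> simp_all [exceeds]
  | cons a A ih =>
    cases A' with
    | nil => simp at hlen
    | cons a' A' =>
      by_cases haa : a = a'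
      · subst haa
        simp only [exceeds, List.headD_cons, List.tail_cons, Bool.and_not_self, Bool.false_or]
          at h h'
        obtain ⟨q, h1, h2⟩ := ih (by simpa using hlen) h h'
        exact ⟨a :: q, by simpa using h1, by simpa using h2⟩
      · refine ⟨[], ?_, ?_⟩ <;> cases a <;> cases a' <;> simp_all [exceeds]

variable (F : Spec)

/-- The entries of a decision list, each given by an input assignment, which determines the test, and
an output assignment. -/
abbrev Spec.Entries (F : Spec) := List ((Fin F.numIn → Bool) × (Fin F.numOut → Bool))

/-- The concatenation of the blocks of the entries. -/
def blocks (E : F.Entries) : List Bool := E.flatMap fun e => block F e.1 e.2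

/-- The pair of assignments satisfies the specification, and none of the tests of `E` is true for the
input assignment. -/
def Candidate (E : F.Entries) (x : Fin F.numIn → Bool) (y : Fin F.numOut → Bool) : Prop :=
  F.Holds x y ∧ ∀ e ∈ E, exceeds (testBits F x) (testBits F e.1) = true

theorem length_blocks (E : F.Entries) : (blocks F E).length = E.length * blockLength F := by
  induction E with
  | nil => simp [blocks]
  | cons e E ih =>
    rw [blocks] at *
    simp only [List.flatMap_cons, List.length_append, ih, length_block, List.length_cons]
    ring

/-- The comparison looks only at as many positions as the new test has, so the output bits of the
earlier blocks and all later blocks are ignored. -/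
theorem exceeds_drop_blocks (E : F.Entries) (P : List Bool) (x : Fin F.numIn → Bool) :
    (∀ i < E.length, exceeds (testBits F x) ((blocks F E ++ P).drop (i * blockLength F)) = true) ↔
      ∀ e ∈ E, exceeds (testBits F x) (testBits F e.1) = true := by
  have hlen : ∀ x', (testBits F x).length = (testBits F x').length := fun x' => by
    have h1 := length_testBits F x
    have h2 := length_testBits F x'
    omega
  induction E with
  | nil => simp
  | cons e E ih =>
    have hb : blocks F (e :: E) ++ P = block F e.1 e.2 ++ (blocks F E ++ P) := by
      simp [blocks]
    have h0 : exceeds (testBits F x) (block F e.1 e.2 ++ (blocks F E ++ P)) =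
        exceeds (testBits F x) (testBits F e.1) := by
      rw [block, List.append_assoc, exceeds_append_right (hlen _)]
    have hs : ∀ i, (block F e.1 e.2 ++ (blocks F E ++ P)).drop ((i + 1) * blockLength F) =
        (blocks F E ++ P).drop (i * blockLength F) := fun i => by
      rw [← length_block F e.1 e.2, Nat.succ_mul, add_comm, ← List.drop_drop, List.drop_left]
    rw [List.forall_mem_cons, hb, ← h0]
    constructor
    · intro h
      refine ⟨by simpa using h 0 (by simp), ih.1 fun i hi => ?_⟩
      rw [← hs]
      exact h (i + 1) (by simpa using hi)
    · rintro ⟨h1, h2⟩ i hi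
      cases i with
      | zero => simpa using h1
      | succ i => rw [hs]; exact ih.2 h2 i (by simpa using hi)

theorem question_blocks_mem_iff (E : F.Entries) {P : List Bool} (hP : P ≠ [])
    (hlen : P.length ≤ blockLength F) :
    question F.encode (blocks F E ++ P).reverse ∈ extensionLanguage ↔
      ∃ x y, Candidate F E x y ∧ P <+: block F x y := by
  have hdrop : (blocks F E ++ P).drop (E.length * blockLength F) = P := by
    rw [← length_blocks, List.drop_left]
  rw [question_mem_iff]
  constructor
  · rintro ⟨x, y, k, hh, hcmp, hne, hpre⟩
    -- The rest of the word after `k` blocks is nonempty and no longer than a block, which leaves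
    -- only one value of `k`.
    have hk : k = E.length := by
      have h1 := List.length_pos_iff.2 hP
      have h2 := List.length_pos_iff.2 hne
      have h3 := hpre.length_le
      rw [length_block] at h3
      simp only [List.length_drop, List.length_append, length_blocks] at h2 h3
      have h4 := blockLength_pos F
      rcases lt_trichotomy k E.length with h | h | h
      · have : (k + 1) * blockLength F ≤ E.length * blockLength F := Nat.mul_le_mul_right _ h
        rw [Nat.succ_mul] at this
        omega
      · exact h
      · have : (E.length + 1) * blockLength F ≤ k * blockLength F := Nat.mul_le_mul_right _ h
        rw [Nat.succ_mul] at this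
        omega
    subst hk
    rw [hdrop] at hpre
    exact ⟨x, y, ⟨hh, (exceeds_drop_blocks F E P x).1 hcmp⟩, hpre⟩
  · rintro ⟨x, y, ⟨hh, hcmp⟩, hpre⟩
    exact ⟨x, y, E.length, hh, (exceeds_drop_blocks F E P x).2 hcmp, by rwa [hdrop],
      by rwa [hdrop]⟩

/-- The search completes the prefix of a block to a block, choosing `true` whenever possible. -/
theorem search_completes_block (E : F.Entries) (d : ℕ) (P : List Bool)
    (hd : P.length + d = blockLength F) (hP : ∃ x y, Candidate F E x y ∧ P <+: block F x y) :
    ∃ x y, Candidate F E x y ∧ P <+: block F x y ∧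
      (∀ q, q ++ [false] <+: block F x y → P.length ≤ q.length →
        ∀ x' y', Candidate F E x' y' → ¬ q ++ [true] <+: block F x' y') ∧
      ∀ N, search F.encode (N + d) (blocks F E ++ P).reverse =
        search F.encode N (blocks F E ++ block F x y).reverse := by
  induction d generalizing P with
  | zero =>
    obtain ⟨x, y, hc, hpre⟩ := hP
    have hlen : P.length = (block F x y).length := by rw [length_block]; omega
    have heq := hpre.eq_of_length hlen
    refine ⟨x, y, hc, hpre, fun q hq hle => ?_, fun N => by rw [heq]; rfl⟩
    have := hq.length_le
    rw [List.length_append, List.length_singleton] at this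
    omega
  | succ d ih =>
    have hmem : ∀ b, question F.encode (b :: (blocks F E ++ P).reverse) ∈ extensionLanguage ↔
        ∃ x y, Candidate F E x y ∧ P ++ [b] <+: block F x y := fun b => by
      rw [← question_blocks_mem_iff F E (by simp) (by simp; omega)]
      simp
    have hstep : ∀ b, (∃ x y, Candidate F E x y ∧ P ++ [b] <+: block F x y) →
        (∀ N, search F.encode (N + 1) (blocks F E ++ P).reverse =
          search F.encode N (b :: (blocks F E ++ P).reverse)) →
        (b = false → ¬ ∃ x y, Candidate F E x y ∧ P ++ [true] <+: block F x y) →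
        ∃ x y, Candidate F E x y ∧ P <+: block F x y ∧
          (∀ q, q ++ [false] <+: block F x y → P.length ≤ q.length →
            ∀ x' y', Candidate F E x' y' → ¬ q ++ [true] <+: block F x' y') ∧
          ∀ N, search F.encode (N + (d + 1)) (blocks F E ++ P).reverse =
            search F.encode N (blocks F E ++ block F x y).reverse := by
      intro b hb hsearch hfalse
      obtain ⟨x, y, hc, hpre, hmax, hs⟩ := ih (P ++ [b]) (by simp; omega) hb
      refine ⟨x, y, hc, (List.prefix_append _ _).trans hpre, fun q hq hle x' y' hc' hq' => ?_,
        fun N => ?_⟩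
      · rcases hle.lt_or_eq with h | h
        · exact hmax q hq (by simp; omega) x' y' hc' hq'
        · have heq : P ++ [b] = q ++ [false] :=
            (List.prefix_of_prefix_length_le hpre hq (by simp [h])).eq_of_length (by simp [h])
          obtain ⟨rfl, hb⟩ := List.append_inj' heq rfl
          exact hfalse (by simpa using hb) ⟨x', y', hc', hq'⟩
      · rw [← hs N, ← add_assoc, hsearch]
        simp
    by_cases ht : ∃ x y, Candidate F E x y ∧ P ++ [true] <+: block F x y
    · exact hstep true ht (fun N => by rw [search, if_pos ((hmem true).2 ht)]) (by simp)
    · obtain ⟨x, y, hc, hpre⟩ := hP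
      have hf : ∃ x y, Candidate F E x y ∧ P ++ [false] <+: block F x y := by
        obtain ⟨s, hs⟩ := hpre
        cases s with
        | nil =>
          have := congrArg List.length hs
          rw [length_block] at this
          simp at this
          omega
        | cons b s =>
          have hb : P ++ [b] <+: block F x y := ⟨s, by simpa using hs⟩
          cases b with
          | false => exact ⟨x, y, hc, hb⟩
          | true => exact absurd ⟨x, y, hc, hb⟩ ht
      exact hstep false hf (fun N => by
        rw [search, if_neg (mt (hmem true).1 ht), if_pos ((hmem false).2 hf)]) fun _ => ht

/-- The input assignments of the entries are in the domain of the specification and falsify maximal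
sets of input clauses. -/
structure GoodEntries (E : F.Entries) : Prop where
  holds : ∀ e ∈ E, F.Holds e.1 e.2
  maximal : ∀ e ∈ E, ∀ x y, F.Holds x y → exceeds (testBits F e.1) (testBits F x) = false →
    exceeds (testBits F x) (testBits F e.1) = false
  pairwise : E.Pairwise fun e e' => exceeds (testBits F e'.1) (testBits F e.1) = true

/-- In terms of falsified sets: a clause falsified by `x` but not by `x''` is also falsified by `x'`
if the set of `x` is contained in that of `x'`. -/
theorem exceeds_trans {x x' x'' : Fin F.numIn → Bool}
    (h : exceeds (testBits F x) (testBits F x'') = true)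
    (h' : exceeds (testBits F x) (testBits F x') = false) :
    exceeds (testBits F x') (testBits F x'') = true := by
  rw [← Bool.not_eq_true, exceeds_testBits] at h'
  rw [exceeds_testBits] at h ⊢
  obtain ⟨C, hC, h1, h2⟩ := h
  exact ⟨C, hC, by simpa using fun h3 => h' ⟨C, hC, h1, h3⟩, h2⟩

/-- The search finds the lexicographically greatest test among the candidates. A solution with a
strictly larger falsified set would again be a candidate, and at the first difference it would have
`true` where the block found has `false`. -/
theorem GoodEntries.exists_append {E : F.Entries} (hE : GoodEntries F E)
    (hcand : ∃ x y, Candidate F E x y) :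
    ∃ e, GoodEntries F (E ++ [e]) ∧ ∀ N, search F.encode (N + blockLength F) (blocks F E).reverse =
      search F.encode N (blocks F (E ++ [e])).reverse := by
  obtain ⟨x, y, hc, -, hmax, hs⟩ := search_completes_block F E (blockLength F) [] (by simp)
    (by simpa using hcand)
  refine ⟨(x, y), ⟨?_, ?_, ?_⟩, fun N => ?_⟩
  · intro e he
    rcases List.mem_append.1 he with he | he
    · exact hE.holds e he
    · rw [List.mem_singleton.1 he]; exact hc.1
  · intro e he x' y' hh hle
    rcases List.mem_append.1 he with he | he
    · exact hE.maximal e he x' y' hh hle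
    · rw [List.mem_singleton.1 he] at hle ⊢
      by_contra hlt
      rw [Bool.not_eq_false] at hlt
      have h1 := length_testBits F x
      have h2 := length_testBits F x'
      obtain ⟨q, hq, hq'⟩ := exists_first_difference
        (show (testBits F x).length = (testBits F x').length by omega) hle hlt
      exact hmax q (hq.trans (List.prefix_append _ _)) (by simp) x' y'
        ⟨hh, fun e' he' => exceeds_trans F (hc.2 e' he') hle⟩
        (hq'.trans (List.prefix_append _ _))
  · rw [List.pairwise_append]
    refine ⟨hE.pairwise, by simp, fun e he e' he' => ?_⟩
    rw [List.mem_singleton.1 he']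
    exact hc.2 e he
  · simpa [blocks] using hs N

/-- The `false` appended on failure is exactly the end marker of the encoding of a decision list. -/
theorem search_stops {E : F.Entries} (hcand : ∀ x y, ¬ Candidate F E x y) (N : ℕ) :
    search F.encode (N + 1) (blocks F E).reverse = (blocks F E ++ [false]).reverse := by
  have hmem : ∀ b, question F.encode (b :: (blocks F E).reverse) ∉ extensionLanguage := by
    intro b hb
    obtain ⟨x, y, h, -⟩ := (question_blocks_mem_iff F E (P := [b]) (by simp) (blockLength_pos F)).1
      (by simpa using hb)
    exact hcand x y h
  rw [search, if_neg (hmem true), if_neg (hmem false)]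
  simp

/-- Here `d` bounds the number of entries still to come. Each one takes `blockLength F` steps of the
search, and the additional step writes the end marker. -/
theorem search_finds_entries {M : ℕ} (hM : ∀ E : F.Entries, GoodEntries F E → E.length ≤ M) (d : ℕ)
    {E : F.Entries} (hE : GoodEntries F E) (hd : M ≤ E.length + d) {N : ℕ}
    (hN : d * blockLength F + 1 ≤ N) :
    ∃ E' : F.Entries, GoodEntries F E' ∧ (∀ x y, ¬ Candidate F E' x y) ∧
      search F.encode N (blocks F E).reverse = (blocks F E' ++ [false]).reverse := by
  induction d generalizing E N with
  | zero =>
    obtain ⟨N', rfl⟩ : ∃ N', N = N' + 1 := ⟨N - 1, by omega⟩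
    have hcand : ∀ x y, ¬ Candidate F E x y := fun x y h => by
      obtain ⟨e, hgood, -⟩ := hE.exists_append F ⟨x, y, h⟩
      have := hM _ hgood
      rw [List.length_append, List.length_singleton] at this
      omega
    exact ⟨E, hE, hcand, search_stops F hcand N'⟩
  | succ d ih =>
    rw [Nat.succ_mul] at hN
    by_cases hcand : ∃ x y, Candidate F E x y
    · obtain ⟨e, hgood, hs⟩ := hE.exists_append F hcand
      obtain ⟨N', rfl⟩ : ∃ N', N = N' + blockLength F := ⟨N - blockLength F, by omega⟩
      rw [hs]
      exact ih hgood (by simp; omega) (by omega)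
    · obtain ⟨N', rfl⟩ : ∃ N', N = N' + 1 := ⟨N - 1, by omega⟩
      push Not at hcand
      exact ⟨E, hE, hcand, search_stops F hcand N'⟩

/-! ### The number of entries -/

/-- The input clauses that an assignment falsifies. -/
def falsified (x : Fin F.numIn → Bool) : Set F.inputClauses := {C | C.1.eval x = false}

/-- Complementary literals cannot both be false. -/
theorem isClique_falsified (x : Fin F.numIn → Bool) :
    (consensusGraph F.inputClauses).IsClique (falsified F x) := by
  intro C hC D hD hne
  rw [consensusGraph, SimpleGraph.compl_adj]
  refine ⟨hne, fun h => ?_⟩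
  obtain ⟨v, b, h1, h2⟩ := h.2
  have hC : C.1.eval x = false := hC
  have hD : D.1.eval x = false := hD
  rw [← Bool.not_eq_true, eval_eq_true_iff] at hC hD
  have e1 : x v ≠ b := fun h => hC ⟨v, by rwa [h]⟩
  have e2 : x v ≠ !b := fun h => hD ⟨v, by rwa [h]⟩
  revert e1 e2
  cases x v <;> cases b <;> simp

/-- Sets of falsified clauses within one clique are within one set of falsified clauses. -/
theorem exists_falsified_superset {K : Set F.inputClauses}
    (hK : (consensusGraph F.inputClauses).IsClique K) :
    ∃ z, ∀ x, falsified F x ⊆ K → falsified F x ⊆ falsified F z := by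
  classical
  -- A vertex of `K` may be a tautological clause, which no assignment falsifies, so only
  -- falsifiable members are kept. The assignment `z` makes a variable false exactly if it occurs
  -- positively in one of them; since no two of them conflict and none conflicts with itself, `z`
  -- falsifies them all.
  let T : Set F.inputClauses := {C | C ∈ K ∧ ∃ x, C.1.eval x = false}
  refine ⟨fun v => !decide (∃ C ∈ T, (v, true) ∈ C.1), fun x hx C hC => ?_⟩
  have hCT : C ∈ T := ⟨hx hC, x, hC⟩
  change C.1.eval _ = false
  have hC : C.1.eval x = false := hC
  rw [← Bool.not_eq_true, eval_eq_true_iff] at hC ⊢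
  rintro ⟨v, hv⟩
  by_cases h : ∃ D ∈ T, (v, true) ∈ D.1
  · obtain ⟨D, hD, hvD⟩ := h
    have hdec : decide (∃ C ∈ T, (v, true) ∈ C.1) = true := decide_eq_true ⟨D, hD, hvD⟩
    rw [hdec, Bool.not_true] at hv
    by_cases hCD : C = D
    · subst hCD
      refine hC ⟨v, ?_⟩
      cases x v
      · exact hv
      · exact hvD
    · have hadj := hK hCT.1 hD.1 hCD
      rw [consensusGraph, SimpleGraph.compl_adj] at hadj
      exact hadj.2 ⟨hCD, v, false, hv, hvD⟩
  · have hdec : decide (∃ C ∈ T, (v, true) ∈ C.1) = false := decide_eq_false h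
    rw [hdec, Bool.not_false] at hv
    exact h ⟨C, hCT, hv⟩

theorem exceeds_eq_false_iff (x x' : Fin F.numIn → Bool) :
    exceeds (testBits F x) (testBits F x') = false ↔ falsified F x ⊆ falsified F x' := by
  rw [← Bool.not_eq_true, exceeds_testBits]
  constructor
  · rintro h ⟨C, hC⟩ hx
    obtain ⟨D, hD, rfl⟩ := List.mem_map.1 (List.mem_toFinset.1 hC)
    change (inPart D).eval x' = false
    by_contra h'
    exact h ⟨D, hD, hx, by simpa using h'⟩
  · rintro h ⟨C, hC, h1, h2⟩
    have : (inPart C).eval x' = false :=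
      h (show (⟨inPart C, List.mem_toFinset.2 (List.mem_map_of_mem hC)⟩ : F.inputClauses) ∈
        falsified F x from h1)
    rw [this] at h2
    cases h2

/-- Each entry is assigned a maximal clique containing its falsified set. If two entries shared a
clique, one assignment `z` would falsify both sets. Realizability puts `z` in the domain, so
maximality makes the earlier set as large as that of `z`, and the later set would be contained in
it. -/
theorem length_le_numMaximalCliques (hF : F.Realizable) (E : F.Entries) (hE : GoodEntries F E) :
    E.length ≤ numMaximalCliques (consensusGraph F.inputClauses) := by
  classical
  have hK : ∀ x, ∃ K, falsified F x ⊆ K ∧ Maximal (consensusGraph F.inputClauses).IsClique K :=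
    fun x => (Set.toFinite {K | (consensusGraph F.inputClauses).IsClique K}).exists_le_maximal
      (isClique_falsified F x)
  choose K hsub hmax using hK
  have hnodup : (E.map fun e => K e.1).Nodup := by
    rw [List.Nodup, List.pairwise_map]
    refine (List.Pairwise.and_mem.1 hE.pairwise).imp fun {e e'} ⟨he, he', h⟩ heq => ?_
    obtain ⟨z, hz⟩ := exists_falsified_superset F (hmax e.1).1
    obtain ⟨y, hy⟩ := hF z
    have h1 := hE.maximal e he z y hy ((exceeds_eq_false_iff F _ _).2 (hz _ (hsub _)))
    have h2 := (exceeds_eq_false_iff F _ _).2 (hz _ (by rw [heq]; exact hsub e'.1))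
    rw [exceeds_trans F h h2] at h1
    cases h1
  calc E.length = (E.map fun e => K e.1).toFinset.card := by
        rw [List.toFinset_card_of_nodup hnodup, List.length_map]
    _ = ((E.map fun e => K e.1).toFinset : Set (Set F.inputClauses)).ncard := by
        rw [Set.ncard_coe_finset]
    _ ≤ _ := by
        refine Set.ncard_le_ncard (fun s hs => ?_) (Set.toFinite _)
        simp only [Finset.mem_coe, List.mem_toFinset, List.mem_map] at hs
        obtain ⟨e, -, rfl⟩ := hs
        exact hmax _

/-! ### The decision list -/

/-- The test of an entry. -/
def entryTest (x : Fin F.numIn → Bool) : List (Clause (Fin F.numIn)) :=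
  if F.numIn = 0 then [] else F.clauses.map (testClause x)

/-- The decision list with the given entries. -/
def entryList (E : F.Entries) : DecisionList F.numIn F.numOut :=
  E.map fun e => (entryTest F e.1, e.2)

/-- Without inputs a clause has no bits and the test is empty, which agrees with the absence of
markers in the blocks. -/
theorem encode_entryList (E : F.Entries) :
    (entryList F E).encode = blocks F E ++ [false] := by
  have h : ∀ x, ((entryTest F x).flatMap fun C => true :: clauseBits C) = clausesBits x F.clauses := by
    intro x
    rw [entryTest, clausesBits]
    split_ifs with h0
    · have h1 : marker (assignmentBits x) = [] := by
        rw [List.eq_nil_of_length_eq_zero (l := assignmentBits x) (by simp [h0])]; rfl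
      have h2 : ∀ C : Clause (Fin F.numIn), clauseBits C = [] := fun C =>
        List.eq_nil_of_length_eq_zero (by simp [h0])
      simp [h1, h2]
    · have h1 : marker (assignmentBits x) = [true] := by
        rw [marker_eq_of_length_eq (Y := List.replicate F.numIn true) (by simp)]
        obtain ⟨k, hk⟩ := Nat.exists_eq_succ_of_ne_zero h0
        rw [hk]; rfl
      simp [h1, List.flatMap_map]
  simp [entryList, DecisionList.encode, List.flatMap_map, h, blocks, block, testBits, assignmentBits]

/-- The test of `z` is true at `x` if and only if `z` falsifies every input clause that `x`
falsifies. A full clause is true as soon as there is a variable; without inputs it would be the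
empty, false clause, which is why the test is then taken to be empty. -/
theorem all_entryTest (x z : Fin F.numIn → Bool) :
    ((entryTest F z).all fun C => C.eval x) = true ↔
      exceeds (testBits F x) (testBits F z) = false := by
  rw [← Bool.not_eq_true (exceeds _ _), exceeds_testBits, entryTest]
  split_ifs with h0
  · simp only [List.all_nil, true_iff]
    rintro ⟨C, -, -, h⟩
    obtain ⟨v, -⟩ := (eval_eq_true_iff _ _).1 h
    exact absurd v.2 (by omega)
  · simp only [List.all_map, List.all_eq_true, Function.comp_apply]
    push Not
    refine forall₂_congr fun C _ => ?_
    unfold testClause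
    rcases hz : (inPart C).eval z with _ | _
    · simp only [Bool.false_eq_true, if_false, ne_eq, not_false_eq_true, implies_true, iff_true]
      exact (eval_eq_true_iff _ _).2 ⟨⟨0, by omega⟩, Finset.mem_univ _⟩
    · simp

/-- An input that passes no test would give a candidate. If `x` passes the test of an entry, every
clause whose input part it falsifies has its input part falsified by the entry too, so the output of
the entry satisfies that clause. -/
theorem implements_entryList (E : F.Entries) (hE : GoodEntries F E)
    (hcover : ∀ x y, ¬ Candidate F E x y) :
    F.Implements (entryList F E).eval := by
  rintro x ⟨y, hy⟩
  have hex : ∃ e ∈ E, exceeds (testBits F x) (testBits F e.1) = false := by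
    by_contra! h
    exact hcover x y ⟨hy, by simpa using h⟩
  rcases hfind : E.find? (fun e => (entryTest F e.1).all fun C => C.eval x) with _ | e
  · obtain ⟨e, he, h⟩ := hex
    exact absurd ((all_entryTest F x e.1).2 h) (List.find?_eq_none.1 hfind e he)
  · refine ⟨e.2, ?_, ?_⟩
    · rw [DecisionList.eval, entryList, List.find?_map]
      simp only [Function.comp_def]
      rw [hfind]
      rfl
    · have h1 := (all_entryTest F x e.1).1 (List.find?_some
        (p := fun e : _ × (Fin F.numOut → Bool) => (entryTest F e.1).all fun C => C.eval x) hfind)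
      have h2 := hE.holds e (List.mem_of_find?_eq_some hfind)
      intro C hC
      have h3 := h2 C hC
      rw [eval_sumElim, Bool.or_eq_true] at h3 ⊢
      refine h3.imp_left fun h4 => ?_
      by_contra h5
      rw [← Bool.not_eq_true, exceeds_testBits] at h1
      exact h1 ⟨C, hC, by simpa using h5, h4⟩

theorem exists_eval_le_pow (q : Polynomial ℕ) : ∃ k, ∀ n, 2 ≤ n → q.eval n ≤ n ^ k := by
  induction q using Polynomial.induction_on' with
  | add p q hp hq =>
    obtain ⟨k, hk⟩ := hp
    obtain ⟨l, hl⟩ := hq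
    refine ⟨k + l + 1, fun n hn => ?_⟩
    have h1 : n ^ k ≤ n ^ (k + l) := Nat.pow_le_pow_right (by omega) (by omega)
    have h2 : n ^ l ≤ n ^ (k + l) := Nat.pow_le_pow_right (by omega) (by omega)
    have h3 : n ^ (k + l) * 2 ≤ n ^ (k + l) * n := Nat.mul_le_mul_left _ hn
    have h4 := hk n hn
    have h5 := hl n hn
    rw [Polynomial.eval_add, pow_succ]
    omega
  | monomial d a =>
    refine ⟨a + d, fun n hn => ?_⟩
    rw [Polynomial.eval_monomial, pow_add]
    gcongr
    -- The coefficient `a` is absorbed into the exponent through `a ≤ 2 ^ a ≤ n ^ a`, which is where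
    -- `2 ≤ n` is needed.
    exact Nat.lt_two_pow_self.le.trans (Nat.pow_le_pow_left hn a)

theorem synthesisInPNP_of_numMaximalCliques_le (𝒞 : Set Spec) (q : Polynomial ℕ)
    (h : ∀ F ∈ 𝒞, numMaximalCliques (consensusGraph F.inputClauses) ≤ q.eval F.size) :
    SynthesisInPNP 𝒞 := by
  -- The clock must allow at most `q` entries of at most the input length each, and one more bit for
  -- the end marker.
  obtain ⟨k, hk⟩ := exists_eval_le_pow (q * Polynomial.X + 1)
  refine ⟨synthesize k, inFPNP_synthesize k, fun F hF hreal => ?_⟩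
  have hM : ∀ E : F.Entries, GoodEntries F E → E.length ≤ q.eval F.size := fun E hE =>
    (length_le_numMaximalCliques F hreal E hE).trans (h F hF)
  have hsize : 2 ≤ F.encode.length := by have := length_encode_ge F; omega
  have hclock : q.eval F.size * blockLength F + 1 ≤ F.encode.length ^ k := by
    refine le_trans ?_ (hk _ hsize)
    rw [Polynomial.eval_add, Polynomial.eval_mul, Polynomial.eval_X, Polynomial.eval_one]
    exact Nat.add_le_add_right (Nat.mul_le_mul_left _ (blockLength_le F)) 1
  obtain ⟨E, hE, hcover, hs⟩ := search_finds_entries F hM (q.eval F.size) (E := [])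
    ⟨by simp, by simp, by simp⟩ (by simp) (N := F.encode.length ^ k) hclock
  refine ⟨entryList F E, ?_, implements_entryList F E hE hcover⟩
  rw [show blocks F [] = [] from rfl, List.reverse_nil] at hs
  rw [encode_entryList, synthesize, hs, List.reverse_reverse]

theorem card_inputClauses_le : Fintype.card F.inputClauses ≤ F.size := by
  have h1 : F.inputClauses.card ≤ F.clauses.length := by
    refine (List.toFinset_card_le _).trans ?_
    simp
  have h2 := length_encode_ge F
  have h3 : F.clauses.length * 1 ≤ F.clauses.length * (1 + 2 * F.numIn) :=
    Nat.mul_le_mul_left _ (by omega)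
  rw [Fintype.card_coe, Spec.size]
  omega

end BoolSynth

theorem theorem1 :
    -- synthesis for specifications with polynomially many maximal cliques
    (∀ (𝒞 : Set BoolSynth.Spec) (q : Polynomial ℕ),
      (∀ F ∈ 𝒞, BoolSynth.numMaximalCliques (BoolSynth.consensusGraph F.inputClauses) ≤
        q.eval F.size) → BoolSynth.SynthesisInPNP 𝒞) ∧
    -- planar graphs and chordal graphs have polynomially many maximal cliques
    (∃ q : Polynomial ℕ, ∀ (V : Type) [Fintype V] (G : SimpleGraph V), BoolSynth.IsPlanar G →
      BoolSynth.numMaximalCliques G ≤ q.eval (Fintype.card V)) ∧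
    (∃ q : Polynomial ℕ, ∀ (V : Type) [Fintype V] (G : SimpleGraph V), BoolSynth.IsChordal G →
      BoolSynth.numMaximalCliques G ≤ q.eval (Fintype.card V)) ∧
    -- hence synthesis for planar and for chordal consensus graphs
    BoolSynth.SynthesisInPNP
      {F | BoolSynth.IsPlanar (BoolSynth.consensusGraph F.inputClauses)} ∧
    BoolSynth.SynthesisInPNP
      {F | BoolSynth.IsChordal (BoolSynth.consensusGraph F.inputClauses)} := by
  refine ⟨BoolSynth.synthesisInPNP_of_numMaximalCliques_le,
    ⟨Polynomial.X ^ 4 + 1, fun V _ G hG => by simpa using hG.numMaximalCliques_le⟩,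
    ⟨Polynomial.X ^ 2 + 1, fun V _ G hG => by simpa using hG.numMaximalCliques_le⟩,
    BoolSynth.synthesisInPNP_of_numMaximalCliques_le _ (Polynomial.X ^ 4 + 1) fun F hF => ?_,
    BoolSynth.synthesisInPNP_of_numMaximalCliques_le _ (Polynomial.X ^ 2 + 1) fun F hF => ?_⟩
  · refine (BoolSynth.IsPlanar.numMaximalCliques_le hF).trans ?_
    simpa using Nat.pow_le_pow_left (BoolSynth.card_inputClauses_le F) 4
  · refine (BoolSynth.IsChordal.numMaximalCliques_le hF).trans ?_
    simpa using Nat.pow_le_pow_left (BoolSynth.card_inputClauses_le F) 2
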